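/- Let $n\ge 2$ be an integer and $\xi_n^{x}=\exp(\pi\sqrt{-1}\,x/n)$ for $x\in\mathbb C$, $\xi_n=\xi_n^1$. Put $\{x\}=\xi_n^{x}-\xi_n^{-x}$, $[x]=\{x\}/\{1\}$, $\{k\}!=\prod_{j=1}^k\{j\}$, and $$\begin{bmatrix}x\\y\end{bmatrix}=\prod_{j=0}^{x-y-1}\frac{\{x-j\}}{\{x-y-j\}}\quad\text{if } x-y\in\{0,1,\dots,n-1\},\qquad \begin{bmatrix}x\\y\end{bmatrix}=0\ \text{ otherwise}.$$ Let $\mathcal U_{\xi_n}(sl_2)$ be the $\mathbb C$-algebra generated by $E,F,K,K^{-1}$ with relations $[E,F]=\frac{K^2-K^{-2}}{\xi_n-\xi_n^{-1}}$, $KE=\xi_nEK$, $KF=\xi_n^{-1}FK$, $KK^{-1}=K^{-1}K=1$ and coproduct $\Delta(E)=E\otimes K+K^{-1}\otimes E$, $\Delta(F)=F\otimes K+K^{-1}\otimes F$, $\Delta(K^{\pm1})=K^{\pm1}\otimes K^{\pm1}$. For $a\in\mathbb C\setminus\frac12\mathbb Z$ let $V^a$ be the $n$-dimensional representation with basis $e^a_0,\dots,e^a_{n-1}$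 and $E e^a_j=[j]e^a_{j-1}$, $F e^a_j=[2a-j]e^a_{j+1}$, $K^{\pm1}e^a_j=\xi_n^{\pm(a-j)}e^a_j$ (where $e^a_{-1}=e^a_n=0$). For $a,b,c\in\mathbb C\setminus\frac12\mathbb Z$ with $a+b-c\in\{0,\dots,n-1\}$ let $Y^{a,b}_c:V^c\to V^a\otimes V^b$ be the linear map $$Y^{a,b}_c(e^c_t)=\sum_{u+v-t=a+b-c}C^{a,b,c}_{u,v,t}\,e^a_u\otimes e^b_v ,$$ \begin{align*}C^{a,b,c}_{u,v,t}={}&\sqrt{-1}^{\,c-a-b}(-1)^{v-t}\,\xi_n^{\frac{v(2b-v+1)-u(2a-u+1)}2}\begin{bmatrix}2c\\2c-t\end{bmatrix}^{-1}\begin{bmatrix}2c\\a+b+c-(n-1)\end{bmatrix}\\&\cdot\sum_{z+w=t}(-1)^z\xi_n^{\frac{(2z-t)(2c-t+1)}2}\begin{bmatrix}a+b-c\\u-z\end{bmatrix}\begin{bmatrix}2a-u+z\\2a-u\end{bmatrix}\begin{bmatrix}2b-v+w\\2b-v\end{bmatrix},\end{align*} where $z,w$ are non-negative integers. Write $A_{xyz}=x+y+z$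 and $B_{xyz}=x+y-z$. Let $a,b,c,d,e,f\in\mathbb C\setminus\frac12\mathbb Z$ be such that $B_{abe},B_{afc},B_{bdf},B_{dec}\in\{0,1,\dots,n-1\}$. Then $Y^{a,b}_e$, $Y^{e,d}_c$, $Y^{b,d}_f$, $Y^{a,f}_c$ are maps of $\mathcal U_{\xi_n}(sl_2)$-modules. Furthermore, there are unique numbers $\left\{\begin{smallmatrix}a&b&e\\d&c&x\end{smallmatrix}\right\}_{\xi_n}$ (the $SL(2,\mathbb C)$ quantum $6j$-symbols), indexed by the $x\in\mathbb C$ with $b+d-x\in\{0,\dots,n-1\}$ and $a+x-c\in\{0,\dots,n-1\}$, such that $$(Y^{a,b}_e\otimes \mathrm{id})\circ Y^{e,d}_c=\sum_{x}\begin{Bmatrix}a&b&e\\d&c&x\end{Bmatrix}_{\xi_n}(\mathrm{id}\otimes Y^{b,d}_x)\circ Y^{a,x}_c\qquad\text{as maps } V^c\to V^a\otimes V^b\otimes V^d .$$ For $x=f$ they are given by \begin{align*}\begin{Bmatrix}a&b&e\\d&c&f\end{Bmatrix}_{\xi_n}={}&(-1)^{n-1+B_{afc}}\begin{bmatrix}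2f+n\\2f+1\end{bmatrix}^{-1}\frac{\{B_{dec}\}!\,\{B_{abe}\}!}{\{B_{bdf}\}!\,\{B_{afc}\}!}\begin{bmatrix}2e\\A_{abe}+1-n\end{bmatrix}\begin{bmatrix}2e\\B_{ecd}\end{bmatrix}^{-1}\\&\cdot\sum_{z=\max(0,\,B_{dec}-B_{bdf})}^{\min(B_{dec},\,B_{afc})}(-1)^z\begin{bmatrix}A_{afc}+1\\2c+z+1\end{bmatrix}\begin{bmatrix}B_{acf}+z\\B_{acf}\end{bmatrix}\begin{bmatrix}B_{bfd}+B_{dec}-z\\B_{bfd}\end{bmatrix}\begin{bmatrix}B_{dce}+z\\B_{dfb}\end{bmatrix}.\end{align*} -/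

import Mathlib

open scoped TensorProduct

noncomputable section

namespace SL2SixJ

/-- `ξ_n ^ a := exp (π √-1 a / n)` for a complex exponent `a`. -/
def xi (n : ℕ) (a : ℂ) : ℂ := Complex.exp (Real.pi * Complex.I * a / n)

/-- `{a} = ξ_n ^ a - ξ_n ^ (-a)`. -/
def br (n : ℕ) (a : ℂ) : ℂ := xi n a - xi n (-a)

/-- `[a] = {a} / {1}`. -/
def qnum (n : ℕ) (a : ℂ) : ℂ := br n a / br n 1

/-- `{k}! = {1}{2}⋯{k}`. -/
def qfact (n k : ℕ) : ℂ := ∏ j ∈ Finset.Icc 1 k, br n j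

open Classical in
/-- The quantum binomial `[a; b] = ∏_{j=0}^{a-b-1} {a-j} / {a-b-j}`, when
`a - b ∈ {0, 1, …, n-1}`; it is `0` for all other pairs. -/
def qbin (n : ℕ) (a b : ℂ) : ℂ :=
  if a - b = (⌊(a - b).re⌋₊ : ℂ) ∧ ⌊(a - b).re⌋₊ < n then
    ∏ j ∈ Finset.range ⌊(a - b).re⌋₊, br n (a - j) / br n (a - b - j)
  else 0

theorem qbin_of_sub_eq {n k : ℕ} {a b : ℂ} (hk : k < n) (h : a - b = k) :
    qbin n a b = ∏ j ∈ Finset.range k, br n (a - j) / br n (a - b - j) := by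
  have hf : ⌊(a - b).re⌋₊ = k := by rw [h]; simp
  unfold qbin
  rw [hf, if_pos ⟨h, hk⟩]

theorem qbin_of_forall_ne {n : ℕ} {a b : ℂ} (h : ∀ k : ℕ, k < n → a - b ≠ k) :
    qbin n a b = 0 := by
  unfold qbin
  rw [if_neg]
  rintro ⟨h1, h2⟩
  exact h _ h2 h1

/-! ### The algebra `U_{ξ_n}(sl_2)` and its coproduct -/

/-- The generators `E`, `F`, `K`, `K⁻¹`. -/
inductive Gen : Type
  | E | F | K | Kinv

/-- The defining relations of `U_q(sl_2)` at `q = ξ_n`. -/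
inductive Rel (n : ℕ) : FreeAlgebra ℂ Gen → FreeAlgebra ℂ Gen → Prop
  | comm : Rel n
      (FreeAlgebra.ι ℂ Gen.E * FreeAlgebra.ι ℂ Gen.F
        - FreeAlgebra.ι ℂ Gen.F * FreeAlgebra.ι ℂ Gen.E)
      ((xi n 1 - (xi n 1)⁻¹)⁻¹ •
        (FreeAlgebra.ι ℂ Gen.K ^ 2 - FreeAlgebra.ι ℂ Gen.Kinv ^ 2))
  | KE : Rel n (FreeAlgebra.ι ℂ Gen.K * FreeAlgebra.ι ℂ Gen.E)
      (xi n 1 • (FreeAlgebra.ι ℂ Gen.E * FreeAlgebra.ι ℂ Gen.K))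
  | KF : Rel n (FreeAlgebra.ι ℂ Gen.K * FreeAlgebra.ι ℂ Gen.F)
      ((xi n 1)⁻¹ • (FreeAlgebra.ι ℂ Gen.F * FreeAlgebra.ι ℂ Gen.K))
  | KKinv : Rel n (FreeAlgebra.ι ℂ Gen.K * FreeAlgebra.ι ℂ Gen.Kinv) 1
  | KinvK : Rel n (FreeAlgebra.ι ℂ Gen.Kinv * FreeAlgebra.ι ℂ Gen.K) 1

/-- The quantized enveloping algebra `U_{ξ_n}(sl_2)`. -/
abbrev U (n : ℕ) : Type := RingQuot (Rel n)

/-- The image of a generator in `U_{ξ_n}(sl_2)`. -/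
def gen (n : ℕ) (g : Gen) : U n := RingQuot.mkAlgHom ℂ (Rel n) (FreeAlgebra.ι ℂ g)

/-- An algebra map out of `U_{ξ_n}(sl_2)` is given by four elements that satisfy the relations. -/
def liftU (n : ℕ) {A : Type*} [Ring A] [Algebra ℂ A] (e f k k' : A)
    (hc : e * f - f * e = (xi n 1 - (xi n 1)⁻¹)⁻¹ • (k ^ 2 - k' ^ 2))
    (hE : k * e = xi n 1 • (e * k)) (hF : k * f = (xi n 1)⁻¹ • (f * k))
    (h1 : k * k' = 1) (h2 : k' * k = 1) : U n →ₐ[ℂ] A :=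
  RingQuot.liftAlgHom ℂ
    ⟨FreeAlgebra.lift ℂ (fun g : Gen => match g with
      | .E => e | .F => f | .K => k | .Kinv => k'), by
      intro x y h
      cases h <;> simp [hc, hE, hF, h1, h2]⟩

@[simp] theorem xi_ne_zero (n : ℕ) (a : ℂ) : xi n a ≠ 0 := Complex.exp_ne_zero _

theorem gen_comm (n : ℕ) : gen n .E * gen n .F - gen n .F * gen n .E
    = (xi n 1 - (xi n 1)⁻¹)⁻¹ • (gen n .K ^ 2 - gen n .Kinv ^ 2) := by
  simpa [gen] using RingQuot.mkAlgHom_rel ℂ (Rel.comm (n := n))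

theorem gen_KE (n : ℕ) : gen n .K * gen n .E = xi n 1 • (gen n .E * gen n .K) := by
  simpa [gen] using RingQuot.mkAlgHom_rel ℂ (Rel.KE (n := n))

theorem gen_KF (n : ℕ) : gen n .K * gen n .F = (xi n 1)⁻¹ • (gen n .F * gen n .K) := by
  simpa [gen] using RingQuot.mkAlgHom_rel ℂ (Rel.KF (n := n))

theorem gen_KKinv (n : ℕ) : gen n .K * gen n .Kinv = 1 := by
  simpa [gen] using RingQuot.mkAlgHom_rel ℂ (Rel.KKinv (n := n))

theorem gen_KinvK (n : ℕ) : gen n .Kinv * gen n .K = 1 := by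
  simpa [gen] using RingQuot.mkAlgHom_rel ℂ (Rel.KinvK (n := n))

theorem gen_EKinv (n : ℕ) : gen n .E * gen n .Kinv = xi n 1 • (gen n .Kinv * gen n .E) := by
  calc gen n .E * gen n .Kinv
      = gen n .Kinv * (gen n .K * gen n .E) * gen n .Kinv := by
        rw [← mul_assoc, gen_KinvK, one_mul]
    _ = xi n 1 • (gen n .Kinv * gen n .E * (gen n .K * gen n .Kinv)) := by
        rw [gen_KE]; simp only [mul_smul_comm, smul_mul_assoc, mul_assoc]
    _ = _ := by rw [gen_KKinv, mul_one]

theorem gen_FKinv (n : ℕ) :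
    gen n .F * gen n .Kinv = (xi n 1)⁻¹ • (gen n .Kinv * gen n .F) := by
  calc gen n .F * gen n .Kinv
      = gen n .Kinv * (gen n .K * gen n .F) * gen n .Kinv := by
        rw [← mul_assoc, gen_KinvK, one_mul]
    _ = (xi n 1)⁻¹ • (gen n .Kinv * gen n .F * (gen n .K * gen n .Kinv)) := by
        rw [gen_KF]; simp only [mul_smul_comm, smul_mul_assoc, mul_assoc]
    _ = _ := by rw [gen_KKinv, mul_one]

/-- The coproduct: `Δ(E) = E ⊗ K + K⁻¹ ⊗ E`, `Δ(F) = F ⊗ K + K⁻¹ ⊗ F`,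
`Δ(K^{±1}) = K^{±1} ⊗ K^{±1}`. -/
def comul (n : ℕ) : U n →ₐ[ℂ] U n ⊗[ℂ] U n :=
  liftU n
    (gen n .E ⊗ₜ[ℂ] gen n .K + gen n .Kinv ⊗ₜ[ℂ] gen n .E)
    (gen n .F ⊗ₜ[ℂ] gen n .K + gen n .Kinv ⊗ₜ[ℂ] gen n .F)
    (gen n .K ⊗ₜ[ℂ] gen n .K)
    (gen n .Kinv ⊗ₜ[ℂ] gen n .Kinv)
    (by
      have hx : xi n 1 ≠ 0 := xi_ne_zero n 1
      have h1 : (gen n .E * gen n .F) ⊗ₜ[ℂ] (gen n .K * gen n .K)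
          - (gen n .F * gen n .E) ⊗ₜ[ℂ] (gen n .K * gen n .K)
          = (xi n 1 - (xi n 1)⁻¹)⁻¹ • ((gen n .K ^ 2) ⊗ₜ[ℂ] (gen n .K ^ 2)
            - (gen n .Kinv ^ 2) ⊗ₜ[ℂ] (gen n .K ^ 2)) := by
        rw [← TensorProduct.sub_tmul, gen_comm, ← TensorProduct.sub_tmul, pow_two (gen n .K),
          TensorProduct.smul_tmul']
      have h2 : (gen n .Kinv * gen n .Kinv) ⊗ₜ[ℂ] (gen n .E * gen n .F)
          - (gen n .Kinv * gen n .Kinv) ⊗ₜ[ℂ] (gen n .F * gen n .E)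
          = (xi n 1 - (xi n 1)⁻¹)⁻¹ • ((gen n .Kinv ^ 2) ⊗ₜ[ℂ] (gen n .K ^ 2)
            - (gen n .Kinv ^ 2) ⊗ₜ[ℂ] (gen n .Kinv ^ 2)) := by
        rw [← TensorProduct.tmul_sub, gen_comm, ← TensorProduct.tmul_sub, pow_two (gen n .Kinv),
          TensorProduct.tmul_smul]
      have h3 : (gen n .E * gen n .Kinv) ⊗ₜ[ℂ] (gen n .K * gen n .F)
          = (gen n .Kinv * gen n .E) ⊗ₜ[ℂ] (gen n .F * gen n .K) := by
        rw [gen_EKinv, gen_KF, TensorProduct.tmul_smul, ← TensorProduct.smul_tmul', smul_smul,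
          inv_mul_cancel₀ hx, one_smul]
      have h4 : (gen n .F * gen n .Kinv) ⊗ₜ[ℂ] (gen n .K * gen n .E)
          = (gen n .Kinv * gen n .F) ⊗ₜ[ℂ] (gen n .E * gen n .K) := by
        rw [gen_FKinv, gen_KE, TensorProduct.tmul_smul, ← TensorProduct.smul_tmul', smul_smul,
          mul_inv_cancel₀ hx, one_smul]
      simp only [mul_add, add_mul, Algebra.TensorProduct.tmul_mul_tmul, h3, h4,
        Algebra.TensorProduct.tmul_pow]
      have := congrArg₂ (· + ·) h1 h2
      simp only [← smul_add, sub_add_sub_cancel] at this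
      rw [← this]
      abel)
    (by
      simp only [mul_add, add_mul, Algebra.TensorProduct.tmul_mul_tmul, gen_KE, gen_KKinv,
        gen_KinvK, TensorProduct.tmul_smul, ← TensorProduct.smul_tmul', smul_add])
    (by
      simp only [mul_add, add_mul, Algebra.TensorProduct.tmul_mul_tmul, gen_KF, gen_KKinv,
        gen_KinvK, TensorProduct.tmul_smul, ← TensorProduct.smul_tmul', smul_add])
    (by simp only [Algebra.TensorProduct.tmul_mul_tmul, gen_KKinv]; rfl)
    (by simp only [Algebra.TensorProduct.tmul_mul_tmul, gen_KinvK]; rfl)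

/-- The tensor product of two representations of `U_{ξ_n}(sl_2)`, formed with the coproduct. -/
def tensorRep (n : ℕ) {M N : Type*} [AddCommGroup M] [Module ℂ M] [AddCommGroup N] [Module ℂ N]
    (ρ : U n →ₐ[ℂ] Module.End ℂ M) (σ : U n →ₐ[ℂ] Module.End ℂ N) :
    U n →ₐ[ℂ] Module.End ℂ (M ⊗[ℂ] N) :=
  (Module.endTensorEndAlgHom (R := ℂ) (S := ℂ) (A := ℂ) (M := M) (N := N)).comp
    ((Algebra.TensorProduct.map ρ σ).comp (comul n))

/-- `f` is a map of `U_{ξ_n}(sl_2)`-modules. -/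
def IsModuleMap (n : ℕ) {M N : Type*} [AddCommGroup M] [Module ℂ M] [AddCommGroup N] [Module ℂ N]
    (ρ : U n →ₐ[ℂ] Module.End ℂ M) (σ : U n →ₐ[ℂ] Module.End ℂ N) (f : M →ₗ[ℂ] N) : Prop :=
  ∀ (x : U n) (m : M), f (ρ x m) = σ x (f m)

/-! ### The representations `V^a` -/

/-- The underlying `n`-dimensional space of each `V^a`. -/
abbrev V (n : ℕ) : Type := Fin n → ℂ

/-- The weight vectors `e_0, …, e_{n-1}`, with `e_k = 0` for `k ≥ n`. -/
def wt (n k : ℕ) : V n := if h : k < n then Pi.single (⟨k, h⟩ : Fin n) 1 else 0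

/-- The linear map out of `V n` with given values on `e_0, …, e_{n-1}`. -/
def ofWt (n : ℕ) {M : Type*} [AddCommGroup M] [Module ℂ M] (g : ℕ → M) : V n →ₗ[ℂ] M :=
  (Pi.basisFun ℂ (Fin n)).constr ℂ (fun j => g j)

theorem ofWt_wt (n : ℕ) {M : Type*} [AddCommGroup M] [Module ℂ M] (g : ℕ → M) {k : ℕ}
    (hk : k < n) : ofWt n g (wt n k) = g k := by
  have := (Pi.basisFun ℂ (Fin n)).constr_basis ℂ (fun j => g j) ⟨k, hk⟩
  simp_all [ofWt, wt]

theorem wt_of_le {n k : ℕ} (hk : n ≤ k) : wt n k = 0 := by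
  simp [wt, Nat.not_lt.mpr hk]

theorem ext_wt {n : ℕ} {M : Type*} [AddCommGroup M] [Module ℂ M] {f g : V n →ₗ[ℂ] M}
    (h : ∀ k, k < n → f (wt n k) = g (wt n k)) : f = g := by
  refine (Pi.basisFun ℂ (Fin n)).ext (fun j => ?_)
  have := h j j.2
  simp_all [wt]

/-- `E e_j = [j] e_{j-1}` (and `E e_0 = 0`, as `[0] = 0`). -/
def opE (n : ℕ) : Module.End ℂ (V n) := ofWt n (fun j => qnum n j • wt n (j - 1))

/-- `F e_j = [2a - j] e_{j+1}` (and `F e_{n-1} = 0`). -/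
def opF (n : ℕ) (a : ℂ) : Module.End ℂ (V n) := ofWt n (fun j => qnum n (2 * a - j) • wt n (j + 1))

/-- `K e_j = ξ_n ^ (a - j) e_j`. -/
def opK (n : ℕ) (a : ℂ) : Module.End ℂ (V n) := ofWt n (fun j => xi n (a - j) • wt n j)

/-- `K⁻¹ e_j = ξ_n ^ (-(a - j)) e_j`. -/
def opKinv (n : ℕ) (a : ℂ) : Module.End ℂ (V n) := ofWt n (fun j => xi n (-(a - j)) • wt n j)

theorem xi_add (n : ℕ) (a b : ℂ) : xi n (a + b) = xi n a * xi n b := by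
  unfold xi; rw [← Complex.exp_add]; congr 1; ring

theorem xi_neg (n : ℕ) (a : ℂ) : xi n (-a) = (xi n a)⁻¹ := by
  unfold xi; rw [← Complex.exp_neg]; congr 1; ring

theorem qnum_zero (n : ℕ) : qnum n 0 = 0 := by simp [qnum, br]

theorem qnum_self (n : ℕ) : qnum n n = 0 := by
  rcases Nat.eq_zero_or_pos n with rfl | hn
  · simp [qnum, br]
  · have h0 : (n : ℂ) ≠ 0 := by exact_mod_cast hn.ne'
    have h1 : xi n n = -1 := by
      unfold xi; rw [mul_div_assoc, div_self h0, mul_one, Complex.exp_pi_mul_I]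
    simp [qnum, br, xi_neg, h1]

/-- The representation `V^a` of `U_{ξ_n}(sl_2)`. -/
def rep (n : ℕ) (a : ℂ) : U n →ₐ[ℂ] Module.End ℂ (V n) :=
  liftU n (opE n) (opF n a) (opK n a) (opKinv n a)
    (by
      refine ext_wt (fun k hk => ?_)
      have hFE : opF n a (opE n (wt n k)) = (qnum n k * qnum n (2 * a - k + 1)) • wt n k := by
        rw [opE, ofWt_wt n _ hk, map_smul]
        rcases k with _ | k
        · simp [qnum_zero]
        · rw [opF, Nat.add_sub_cancel, ofWt_wt n _ (by omega), smul_smul]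
          push_cast
          ring_nf
      have hEF : opE n (opF n a (wt n k)) = (qnum n (2 * a - k) * qnum n (k + 1)) • wt n k := by
        rw [opF, ofWt_wt n _ hk, map_smul]
        rcases Nat.lt_or_ge (k + 1) n with h | h
        · rw [opE, ofWt_wt n _ h, smul_smul, Nat.add_sub_cancel]
          push_cast
          rfl
        · have hn : ((k : ℂ) + 1) = (n : ℂ) := by
            have : k + 1 = n := by omega
            exact_mod_cast this
          rw [wt_of_le h, hn, qnum_self]
          simp
      have hK : opK n a (opK n a (wt n k)) = (xi n (a - k) * xi n (a - k)) • wt n k := by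
        rw [opK, ofWt_wt n _ hk, map_smul, ofWt_wt n _ hk, smul_smul]
      have hK' : opKinv n a (opKinv n a (wt n k))
          = (xi n (-(a - k)) * xi n (-(a - k))) • wt n k := by
        rw [opKinv, ofWt_wt n _ hk, map_smul, ofWt_wt n _ hk, smul_smul]
      simp only [LinearMap.sub_apply, Module.End.mul_apply, LinearMap.smul_apply, pow_two, hFE,
        hEF, hK, hK', ← sub_smul, smul_smul]
      congr 1
      have e1 : 2 * a - (k : ℂ) = a + (a - k) := by ring
      have e2 : a + (a - (k : ℂ)) + 1 = (a + 1) + (a - k) := by ring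
      have ha : xi n a = xi n (a - k) * xi n k := by rw [← xi_add]; ring_nf
      have hx := xi_ne_zero n 1
      have hy := xi_ne_zero n (a - k)
      have hz := xi_ne_zero n k
      simp only [qnum, br, e1, e2, xi_neg, xi_add, ha]
      by_cases hq : xi n 1 - (xi n 1)⁻¹ = 0
      · simp [hq]
      · have hq' : xi n 1 ^ 2 - 1 ≠ 0 := by
          intro h0
          apply hq
          field_simp
          simpa using h0
        field_simp
        ring)
    (by
      refine ext_wt (fun k hk => ?_)
      simp only [Module.End.mul_apply, LinearMap.smul_apply]
      rw [opE, opK, ofWt_wt n _ hk, ofWt_wt n _ hk, map_smul, map_smul, ofWt_wt n _ hk]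
      rcases k with _ | k
      · simp [qnum_zero]
      · rw [Nat.add_sub_cancel, ofWt_wt n _ (by omega), smul_smul, smul_smul, smul_smul]
        congr 1
        have : a - (k : ℂ) = 1 + (a - ((k + 1 : ℕ) : ℂ)) := by push_cast; ring
        rw [this, xi_add]
        ring)
    (by
      refine ext_wt (fun k hk => ?_)
      simp only [Module.End.mul_apply, LinearMap.smul_apply]
      rw [opF, opK, ofWt_wt n _ hk, ofWt_wt n _ hk, map_smul, map_smul, ofWt_wt n _ hk]
      rcases Nat.lt_or_ge (k + 1) n with h | h
      · rw [ofWt_wt n _ h, smul_smul, smul_smul, smul_smul]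
        congr 1
        have : a - (k : ℂ) = 1 + (a - ((k + 1 : ℕ) : ℂ)) := by push_cast; ring
        rw [this, xi_add]
        field_simp [xi_ne_zero n 1]
      · simp [wt_of_le h])
    (by
      refine ext_wt (fun k hk => ?_)
      rw [Module.End.mul_apply, opK, opKinv, ofWt_wt n _ hk, map_smul, ofWt_wt n _ hk, smul_smul,
        xi_neg, inv_mul_cancel₀ (xi_ne_zero _ _)]
      simp)
    (by
      refine ext_wt (fun k hk => ?_)
      rw [Module.End.mul_apply, opK, opKinv, ofWt_wt n _ hk, map_smul, ofWt_wt n _ hk, smul_smul,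
        xi_neg, mul_inv_cancel₀ (xi_ne_zero _ _)]
      simp)

/-! ### Clebsch-Gordan quantum coefficients and the `6j`-symbols -/

/-- The Clebsch-Gordan quantum coefficient `C^{a,b,c}_{u,v,t}`; the sum is over `z + w = t`. -/
def cgqc (n : ℕ) (a b c : ℂ) (u v t : ℕ) : ℂ :=
  Complex.I ^ (c - a - b) * (-1) ^ ((v : ℤ) - (t : ℤ)) *
    xi n ((v * (2 * b - v + 1) - u * (2 * a - u + 1)) / 2) *
    (qbin n (2 * c) (2 * c - t))⁻¹ * qbin n (2 * c) (a + b + c - (n - 1)) *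
    ∑ z ∈ Finset.range (t + 1),
      (-1) ^ z * xi n ((2 * (z : ℂ) - (t : ℂ)) * (2 * c - (t : ℂ) + 1) / 2) *
        qbin n (a + b - c) ((u : ℂ) - (z : ℂ)) *
        qbin n (2 * a - (u : ℂ) + (z : ℂ)) (2 * a - (u : ℂ)) *
        qbin n (2 * b - (v : ℂ) + ((t : ℂ) - (z : ℂ))) (2 * b - (v : ℂ))

open Classical in
/-- The inclusion `Y_c^{a,b} : V^c → V^a ⊗ V^b`,
`e_t ↦ ∑_{u + v - t = a + b - c} C^{a,b,c}_{u,v,t} e_u ⊗ e_v`. -/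
def Y (n : ℕ) (a b c : ℂ) : V n →ₗ[ℂ] V n ⊗[ℂ] V n :=
  ofWt n (fun t => ∑ u ∈ Finset.range n, ∑ v ∈ Finset.range n,
    if (u : ℂ) + v - t = a + b - c then cgqc n a b c u v t • (wt n u ⊗ₜ[ℂ] wt n v) else 0)

/-- The composition `V^j → V^{j₁₂} ⊗ V^{j₃} → (V^{j₁} ⊗ V^{j₂}) ⊗ V^{j₃} ≅ V^{j₁} ⊗ (V^{j₂} ⊗ V^{j₃})`. -/
def leftIncl (n : ℕ) (j₁ j₂ j₃ j j₁₂ : ℂ) : V n →ₗ[ℂ] V n ⊗[ℂ] (V n ⊗[ℂ] V n) :=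
  (TensorProduct.assoc ℂ (V n) (V n) (V n)).toLinearMap ∘ₗ
    (Y n j₁ j₂ j₁₂).rTensor (V n) ∘ₗ Y n j₁₂ j₃ j

/-- The composition `V^j → V^{j₁} ⊗ V^{j₂₃} → V^{j₁} ⊗ (V^{j₂} ⊗ V^{j₃})`. -/
def rightIncl (n : ℕ) (j₁ j₂ j₃ j j₂₃ : ℂ) : V n →ₗ[ℂ] V n ⊗[ℂ] (V n ⊗[ℂ] V n) :=
  (Y n j₂ j₃ j₂₃).lTensor (V n) ∘ₗ Y n j₁ j₂₃ j

open Classical in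
/-- The colors `j₂₃` for which the right-hand composition exists:
`j₂ + j₃ - j₂₃` and `j₁ + j₂₃ - j` both lie in `{0, 1, …, n-1}`. -/
def channels (n : ℕ) (j₁ j₂ j₃ j : ℂ) : Finset ℂ :=
  ((Finset.range n).image (fun k : ℕ => j₂ + j₃ - k)).filter
    (fun x => ∃ k : ℕ, k < n ∧ j₁ + x - j = k)

/-- The defining relation of the `6j`-symbols: `X j₂₃`, for `j₂₃` in the channels, are
coefficients that express the left-hand composition in terms of the right-hand ones. -/
def IsSixJ (n : ℕ) (j₁ j₂ j₁₂ j₃ j : ℂ) (X : ℂ → ℂ) : Prop :=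
  leftIncl n j₁ j₂ j₃ j j₁₂ = ∑ x ∈ channels n j₁ j₂ j₃ j, X x • rightIncl n j₁ j₂ j₃ j x

open Classical in
/-- The `SL(2, ℂ)` quantum `6j`-symbol `{j₁ j₂ j₁₂; j₃ j j₂₃}_{ξ_n}`, for `j₂₃` in the channels. -/
def sixJ (n : ℕ) (j₁ j₂ j₁₂ j₃ j j₂₃ : ℂ) : ℂ :=
  if h : ∃ X, IsSixJ n j₁ j₂ j₁₂ j₃ j X then h.choose j₂₃ else 0

/-- `a ∈ ℂ ∖ ½ℤ`. -/
def NotHalfInt (a : ℂ) : Prop := ∀ k : ℤ, a ≠ k / 2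

/-- `A_{xyz} = x + y + z`. -/
def A (x y z : ℂ) : ℂ := x + y + z

/-- `B_{xyz} = x + y - z`. -/
def B (x y z : ℂ) : ℂ := x + y - z

end SL2SixJ

end

namespace SL2SixJ

/-! ### Quantum numbers, factorials and shifted factorials -/

/-! Both sides of the defining relation are module maps out of V^c. Such a map is determined by the
image of e_0, because F e_j = [2c-j] e_{j+1} and [2c-j] ≠ 0 for 2c not an integer
(`eq_zero_of_map_wt_zero`). The image of e_0 is killed by E, and a vector of V^a ⊗ V^b ⊗ V^d killed
by E is determined by its coordinates at e_u ⊗ e_0 ⊗ e_w: the equation E x = 0 expresses [v+1] times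
a coordinate with middle index v+1 by coordinates with middle index v (`eq_zero_of_E_eq_zero`). By
weight, only u + w = N = a+b+d-c matters. The relation thus becomes a square linear system
(`isSixJ_iff`), with one equation for each admissible w and one unknown for each channel x = b+d-k,
where w and k run over the same interval. No decomposition of the triple tensor product is needed.

At these coordinates each Clebsch–Gordan sum has a single nonzero term (`leftIncl_coord`,
`rightIncl_coord`). After division by the common factor `slicePhase`, the left side is a product
`leftCoef`, and the right side is a diagonal factor `rightCoef` times the unitriangular matrix
`tri`. The inverse `triInv` is explicit, by a degenerate case of the q-Saalschütz sum, and
`rightCoef` does not vanish; this gives existence and uniqueness at once.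

The solution, the sum over w of `triInv` times `leftCoef`, is a terminating balanced series. Sears'
transformation (`sears`, two applications of `saalschutz`) turns it into the stated sum over z; this
is `solution_eq_closed`.

That the Y are module maps rests on `isModuleMap_ofWt`, which reduces the claim to F, K, K⁻¹ and the
action of E on e_0, and on the recurrence `cgSum_succ` for the Clebsch–Gordan sum. -/

theorem xi_zero (n : ℕ) : xi n 0 = 1 := by simp [xi]

theorem br_zero (n : ℕ) : br n 0 = 0 := by simp [br]

theorem br_neg (n : ℕ) (x : ℂ) : br n (-x) = -br n x := by simp [br]

/-- Product-to-sum form: it makes every quadratic identity between quantum numbers linear in powers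
of ξ, hence provable by `ring_nf`. -/
theorem br_mul_br (n : ℕ) (x y : ℂ) :
    br n x * br n y = (xi n (x + y) + xi n (-(x + y))) - (xi n (x - y) + xi n (-(x - y))) := by
  have h1 : -(x + y) = -x + -y := by ring
  have h2 : -(x - y) = -x + y := by ring
  rw [h1, h2, sub_eq_add_neg x y]
  simp only [br, xi_add]
  ring

/-- {x} = 2i sin(πx/n). -/
theorem br_eq_zero_iff {n : ℕ} (hn : n ≠ 0) (x : ℂ) : br n x = 0 ↔ ∃ k : ℤ, x = k * n := by
  have hn' : (n : ℂ) ≠ 0 := Nat.cast_ne_zero.mpr hn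
  have hpi : (Real.pi : ℂ) ≠ 0 := Complex.ofReal_ne_zero.mpr Real.pi_ne_zero
  have h : br n x = 2 * Complex.I * Complex.sin (Real.pi * x / n) := by
    have e1 : (Real.pi : ℂ) * Complex.I * x / n = (Real.pi * x / n) * Complex.I := by ring
    have e2 : (Real.pi : ℂ) * Complex.I * (-x) / n = -((Real.pi * x / n) * Complex.I) := by ring
    rw [Complex.sin, br, xi, xi, e1, e2]
    ring_nf
    rw [Complex.I_sq]
    ring
  rw [h, mul_eq_zero, or_iff_right (by simp), Complex.sin_eq_zero_iff]
  refine exists_congr fun k => ⟨fun hk => ?_, fun hk => ?_⟩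
  · field_simp at hk
    linear_combination hk
  · rw [hk]
    field_simp

theorem br_natCast_ne_zero {n j : ℕ} (h0 : j ≠ 0) (hj : j < n) : br n j ≠ 0 := by
  rw [Ne, br_eq_zero_iff (by omega)]
  rintro ⟨k, hk⟩
  have hk' : (j : ℤ) = k * n := by exact_mod_cast hk
  have : (n : ℤ) ∣ j := ⟨k, by rw [hk']; ring⟩
  have := Nat.le_of_dvd (by omega) (Int.natCast_dvd_natCast.mp this)
  omega

/-- `x` is not an integer. -/
def NotInt (x : ℂ) : Prop := ∀ k : ℤ, x ≠ k

/-- The shifted number enters through an equation, so that it may have any syntactic form. -/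
theorem NotInt.add_int {x y : ℂ} (hx : NotInt x) (k : ℤ) (h : y = x + k) : NotInt y := by
  rintro l hl
  exact hx (l - k) (by push_cast; linear_combination hl - h)

theorem NotInt.neg {x : ℂ} (hx : NotInt x) : NotInt (-x) := by
  intro k hk
  exact hx (-k) (by push_cast; linear_combination -hk)

theorem NotHalfInt.two_mul {a : ℂ} (h : NotHalfInt a) : NotInt (2 * a) := by
  intro k hk
  exact h k (by linear_combination hk / 2)

theorem br_ne_zero {n : ℕ} (hn : n ≠ 0) {x : ℂ} (hx : NotInt x) : br n x ≠ 0 := by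
  rw [Ne, br_eq_zero_iff hn]
  rintro ⟨k, hk⟩
  exact hx (k * n) (by push_cast; exact hk)

theorem br_natCast_self (n : ℕ) : br n n = 0 := by
  rcases Nat.eq_zero_or_pos n with rfl | hn
  · simp [br]
  · exact (br_eq_zero_iff hn.ne' _).mpr ⟨1, by simp⟩

theorem xi_self {n : ℕ} (hn : n ≠ 0) : xi n n = -1 := by
  have h0 : (n : ℂ) ≠ 0 := by exact_mod_cast hn
  unfold xi
  rw [mul_div_assoc, div_self h0, mul_one, Complex.exp_pi_mul_I]

theorem br_add_self {n : ℕ} (hn : n ≠ 0) (x : ℂ) : br n (x + n) = -br n x := by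
  have h : -(x + n) = -x + -(n : ℂ) := by ring
  rw [br, h, xi_add, xi_add, xi_neg n n, xi_self hn, br]
  norm_num
  ring

theorem qfact_zero (n : ℕ) : qfact n 0 = 1 := by simp [qfact]

theorem qfact_succ (n k : ℕ) : qfact n (k + 1) = qfact n k * br n (k + 1) := by
  rw [qfact, Finset.prod_Icc_succ_top (by omega), qfact]
  push_cast
  rfl

theorem qfact_ne_zero {n k : ℕ} (hk : k < n) : qfact n k ≠ 0 := by
  refine Finset.prod_ne_zero_iff.mpr fun j hj => ?_
  rw [Finset.mem_Icc] at hj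
  exact br_natCast_ne_zero (by omega) (by omega)

/-- The falling factorial `{x}{x-1}⋯{x-k+1}`. -/
noncomputable def ff (n : ℕ) (x : ℂ) (k : ℕ) : ℂ := ∏ j ∈ Finset.range k, br n (x - j)

/-- The rising factorial `{x}{x+1}⋯{x+k-1}`. -/
noncomputable def poch (n : ℕ) (x : ℂ) (k : ℕ) : ℂ := ∏ j ∈ Finset.range k, br n (x + j)

@[simp] theorem ff_zero (n : ℕ) (x : ℂ) : ff n x 0 = 1 := by simp [ff]

@[simp] theorem poch_zero (n : ℕ) (x : ℂ) : poch n x 0 = 1 := by simp [poch]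

theorem ff_add (n : ℕ) (x : ℂ) (k l : ℕ) : ff n x (k + l) = ff n x k * ff n (x - k) l := by
  rw [ff, Finset.prod_range_add, ff, ff]
  congr 1
  refine Finset.prod_congr rfl fun j _ => ?_
  push_cast
  ring_nf

theorem poch_add (n : ℕ) (x : ℂ) (k l : ℕ) :
    poch n x (k + l) = poch n x k * poch n (x + k) l := by
  rw [poch, Finset.prod_range_add, poch, poch]
  congr 1
  refine Finset.prod_congr rfl fun j _ => ?_
  push_cast
  ring_nf

theorem poch_succ (n : ℕ) (x : ℂ) (k : ℕ) : poch n x (k + 1) = poch n x k * br n (x + k) := by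
  rw [poch, Finset.prod_range_succ, poch]

theorem poch_succ' (n : ℕ) (x : ℂ) (k : ℕ) : poch n x (k + 1) = br n x * poch n (x + 1) k := by
  rw [add_comm k 1, poch_add]
  simp [poch]

theorem ff_succ (n : ℕ) (x : ℂ) (k : ℕ) : ff n x (k + 1) = ff n x k * br n (x - k) := by
  rw [ff, Finset.prod_range_succ, ff]

theorem poch_neg (n : ℕ) (x : ℂ) (k : ℕ) : poch n (-x) k = (-1) ^ k * ff n x k := by
  induction k with
  | zero => simp
  | succ k ih =>
    rw [poch_succ, ff_succ, ih, show -x + (k : ℂ) = -(x - k) by ring, br_neg]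
    ring

theorem poch_eq_ff {n : ℕ} {x y : ℂ} (k : ℕ) (h : y = x + k - 1) : poch n x k = ff n y k := by
  rw [poch, ← Finset.prod_range_reflect, ff]
  refine Finset.prod_congr rfl fun j hj => ?_
  rw [Finset.mem_range] at hj
  obtain ⟨l, rfl⟩ : ∃ l, k = j + 1 + l := ⟨k - 1 - j, by omega⟩
  rw [show j + 1 + l - 1 - j = l by omega, h]
  congr 1
  push_cast
  ring

theorem ff_ne_zero {n : ℕ} (hn : n ≠ 0) {x : ℂ} (hx : NotInt x) (k : ℕ) : ff n x k ≠ 0 :=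
  Finset.prod_ne_zero_iff.mpr fun j _ => br_ne_zero hn (hx.add_int (-j) (by push_cast; ring))

theorem poch_ne_zero {n : ℕ} (hn : n ≠ 0) {x : ℂ} (hx : NotInt x) (k : ℕ) : poch n x k ≠ 0 :=
  Finset.prod_ne_zero_iff.mpr fun j _ => br_ne_zero hn (hx.add_int j (by push_cast; ring))

theorem qfact_add (n k l : ℕ) : qfact n (k + l) = qfact n k * poch n (k + 1) l := by
  induction l with
  | zero => simp
  | succ l ih =>
    rw [← add_assoc, qfact_succ, ih, poch_succ, mul_assoc]
    push_cast
    ring_nf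

theorem ff_natCast_mul_qfact (n k l : ℕ) : ff n (k + l : ℕ) l * qfact n k = qfact n (k + l) := by
  rw [qfact_add, mul_comm, poch_eq_ff l]
  push_cast
  ring

/-! ### The q-Saalschütz summation and Sears' transformation -/

/-- The q-Pfaff–Saalschütz sum, in polynomial form. -/
theorem saalschutz {n m : ℕ} (hm : m < n) (a b c s : ℂ) (hs : s = c - a - b) :
    ∑ k ∈ Finset.range (m + 1), poch n a k * poch n b k * poch n (c + k) (m - k) *
        poch n s (m - k) / (qfact n k * qfact n (m - k)) =
      poch n (c - a) m * poch n (c - b) m / qfact n m := by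
  induction m with
  | zero => simp [qfact_zero]
  | succ m ih =>
    have ih := ih (by omega)
    have hm1 : br n (m + 1) ≠ 0 := by exact_mod_cast br_natCast_ne_zero (by omega) hm
    have hq : qfact n m ≠ 0 := qfact_ne_zero (by omega)
    -- Telescoping certificate: {m+1} times the summand for m+1 is {c-a+m}{c-b+m} times the summand
    -- for m, plus G(k+1) - G(k). The boundary term G(m+1) cancels the extra summand k = m+1.
    set G : ℕ → ℂ := fun k => -(br n k * (poch n a k * poch n b k * poch n (c + k - 1) (m + 1 - k) *
      poch n s (m + 1 - k) / (qfact n k * qfact n (m + 1 - k)))) with hG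
    have key : ∀ k ∈ Finset.range (m + 1),
        br n (m + 1) * (poch n a k * poch n b k * poch n (c + k) (m + 1 - k) *
          poch n s (m + 1 - k) / (qfact n k * qfact n (m + 1 - k))) =
        br n (c - a + m) * br n (c - b + m) * (poch n a k * poch n b k * poch n (c + k) (m - k) *
          poch n s (m - k) / (qfact n k * qfact n (m - k))) + (G (k + 1) - G k) := by
      intro k hk
      obtain ⟨l, rfl⟩ : ∃ l, m = k + l := ⟨m - k, by rw [Finset.mem_range] at hk; omega⟩
      have e1 : k + l + 1 - k = l + 1 := by omega
      have e2 : k + l + 1 - (k + 1) = l := by omega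
      have e3 : k + l - k = l := by omega
      have hk0 : qfact n k ≠ 0 := qfact_ne_zero (by omega)
      have hl0 : qfact n l ≠ 0 := qfact_ne_zero (by omega)
      have hk1 : br n ((k : ℂ) + 1) ≠ 0 := by
        exact_mod_cast br_natCast_ne_zero (n := n) (j := k + 1) (by omega) (by omega)
      have hl1 : br n ((l : ℂ) + 1) ≠ 0 := by
        exact_mod_cast br_natCast_ne_zero (n := n) (j := l + 1) (by omega) (by omega)
      simp only [hG, e1, e2, e3, qfact_succ]
      rw [poch_succ n (c + k) l, poch_succ' n (c + k - 1) l, poch_succ n s l, poch_succ n a k,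
        poch_succ n b k]
      have f1 : c + ((k + 1 : ℕ) : ℂ) - 1 = c + k := by push_cast; ring
      have f2 : c + (k : ℂ) - 1 + 1 = c + k := by ring
      rw [f1, f2]
      push_cast
      -- The two product-to-sum identities behind the certificate; the rest is clearing
      -- denominators.
      have A1 : br n ((k : ℂ) + l + 1) * br n (c + k + l) - br n k * br n (c + k - 1)
          = br n (l + 1) * br n (c + k + l + k) := by
        simp only [br_mul_br]; ring_nf
      have A2 : br n (c - a + (k + l)) * br n (c - b + (k + l)) - br n (a + k) * br n (b + k)
          = br n (c + k + l + k) * br n (s + l) := by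
        rw [hs]; simp only [br_mul_br]; ring_nf
      field_simp
      linear_combination (poch n a k * poch n b k * poch n (c + k) l * poch n s l) *
        (br n (s + l) * A1 - br n (l + 1) * A2)
    have hsum := Finset.sum_congr rfl key
    rw [← Finset.mul_sum, Finset.sum_add_distrib, ← Finset.mul_sum, ih, Finset.sum_range_sub] at hsum
    have hG0 : G 0 = 0 := by simp [hG, br_zero]
    have hGm : G (m + 1) = -(br n (m + 1) * (poch n a (m + 1) * poch n b (m + 1) /
        (qfact n (m + 1)))) := by
      simp [hG, qfact_zero]
    rw [hG0, hGm] at hsum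
    rw [Finset.sum_range_succ, poch_succ n (c - a), poch_succ n (c - b), qfact_succ]
    rw [qfact_succ] at hsum
    apply mul_left_cancel₀ hm1
    rw [mul_add, hsum]
    simp only [Nat.sub_self, poch_zero, qfact_zero]
    field_simp
    ring

/-- Sears' transformation of terminating balanced series, in polynomial form. -/
theorem sears {n t : ℕ} (ht : t < n) (A B C D K S E : ℂ) (hS : S = C - A - B)
    (hE : E = D - K - S) (hC : ∀ y ≤ t, poch n C y ≠ 0) :
    ∑ y ∈ Finset.range (t + 1), poch n K y * poch n (C - A) y * poch n (C - B) y / poch n C y *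
        poch n (D + y) (t - y) * poch n E (t - y) / (qfact n y * qfact n (t - y)) =
      ∑ i ∈ Finset.range (t + 1), poch n K i * poch n A i * poch n B i / poch n C i *
        poch n (D - K) (t - i) * poch n (D + i - S) (t - i) / (qfact n i * qfact n (t - i)) := by
  -- Expand (C-A)_y (C-B)_y / {y}! by Saalschütz with parameters A, B, C.
  have h1 : ∀ y ∈ Finset.range (t + 1),
      poch n K y * poch n (C - A) y * poch n (C - B) y / poch n C y *
        poch n (D + y) (t - y) * poch n E (t - y) / (qfact n y * qfact n (t - y)) =
      ∑ i ∈ Finset.range (y + 1), poch n A i * poch n B i / poch n C i / qfact n i *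
        (poch n K y * poch n S (y - i) * poch n (D + y) (t - y) * poch n E (t - y) /
          (qfact n (y - i) * qfact n (t - y))) := by
    intro y hy
    rw [Finset.mem_range] at hy
    have hs := saalschutz (n := n) (m := y) (by omega) A B C S hS
    have hc := hC y (by omega)
    calc _ = (poch n K y * poch n (D + y) (t - y) * poch n E (t - y) / poch n C y /
          qfact n (t - y)) * (poch n (C - A) y * poch n (C - B) y / qfact n y) := by
          field_simp
      _ = _ := by
          rw [← hs, Finset.mul_sum]
          refine Finset.sum_congr rfl fun i hi => ?_
          rw [Finset.mem_range] at hi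
          have hci := hC i (by omega)
          obtain ⟨p, rfl⟩ : ∃ p, y = i + p := ⟨y - i, by omega⟩
          have e : i + p - i = p := by omega
          rw [e]
          rw [poch_add n C] at hc ⊢
          have := right_ne_zero_of_mul hc
          field_simp
  -- After interchanging the sums, the inner sum over p = y - i is again a Saalschütz sum, with
  -- parameters K+i, S, D+i; the condition on E is its balancing condition.
  have h2 : ∀ i ∈ Finset.range (t + 1),
      poch n K i * poch n A i * poch n B i / poch n C i *
        poch n (D - K) (t - i) * poch n (D + i - S) (t - i) / (qfact n i * qfact n (t - i)) =
      ∑ p ∈ Finset.range (t - i + 1), poch n A i * poch n B i / poch n C i / qfact n i *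
        (poch n K (i + p) * poch n S p * poch n (D + (i + p : ℕ)) (t - (i + p)) *
          poch n E (t - (i + p)) / (qfact n p * qfact n (t - (i + p)))) := by
    intro i hi
    rw [Finset.mem_range] at hi
    have hs := saalschutz (n := n) (m := t - i) (by omega) (K + i) S (D + i) E (by rw [hE]; ring)
    rw [show D + (i : ℂ) - (K + i) = D - K by ring] at hs
    calc _ = (poch n A i * poch n B i / poch n C i / qfact n i * poch n K i) *
          (poch n (D - K) (t - i) * poch n (D + i - S) (t - i) / qfact n (t - i)) := by
          field_simp
      _ = _ := by
          rw [← hs, Finset.mul_sum]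
          refine Finset.sum_congr rfl fun p _ => ?_
          rw [poch_add, show t - (i + p) = t - i - p by omega]
          push_cast
          rw [← add_assoc]
          ring
  rw [Finset.sum_congr rfl h1, Finset.sum_congr rfl h2, Finset.sum_sigma', Finset.sum_sigma']
  refine Finset.sum_bij' (fun x _ => ⟨x.2, x.1 - x.2⟩) (fun x _ => ⟨x.1 + x.2, x.1⟩) ?_ ?_ ?_ ?_ ?_
  all_goals
    rintro ⟨x, y⟩ h
    simp only [Finset.mem_sigma, Finset.mem_range] at h ⊢
  · omega
  · omega
  · simp; omega
  · simp
  · have : y + (x - y) = x := by omega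
    rw [this]

/-! ### Inversion of the triangular matrix -/

/-- Saalschütz with a = b = c: the right side contains {0}, and (b)_k (b+k)_{m-k} = (b)_m factors
out of the left side. -/
theorem sum_poch_mul_poch_neg {n m : ℕ} (hn : 0 < m) (hm : m < n) (b : ℂ) (hb : NotInt b) :
    ∑ k ∈ Finset.range (m + 1), poch n b k * poch n (-b) (m - k) /
      (qfact n k * qfact n (m - k)) = 0 := by
  have h := saalschutz hm b b b (-b) (by ring)
  have hz : poch n (b - b) m = 0 :=
    Finset.prod_eq_zero (i := 0) (by simpa using hn) (by simp [br_zero])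
  have hb0 := poch_ne_zero (by omega : n ≠ 0) hb m
  rw [hz, zero_mul, zero_div] at h
  apply mul_left_cancel₀ hb0
  rw [mul_zero, ← h, Finset.mul_sum]
  refine Finset.sum_congr rfl fun k hk => ?_
  rw [Finset.mem_range] at hk
  obtain ⟨l, rfl⟩ : ∃ l, m = k + l := ⟨m - k, by omega⟩
  rw [poch_add, Nat.add_sub_cancel_left]
  ring

/-- The triangular matrix `1 / ({w-k}! {γ-2k}{γ-2k-1}⋯{γ-k-w+1})`. -/
noncomputable def tri (n : ℕ) (γ : ℂ) (w k : ℕ) : ℂ :=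
  if k ≤ w then 1 / (qfact n (w - k) * ff n (γ - 2 * k) (w - k)) else 0

/-- The inverse of the matrix `tri`. -/
noncomputable def triInv (n : ℕ) (γ : ℂ) (k w : ℕ) : ℂ :=
  if w ≤ k then (-1) ^ (k - w) / (qfact n (k - w) * ff n (γ - k - w + 1) (k - w)) else 0

/-- Multiplied by the falling factorials of length m at δ and at δ-m+1, this is (-1)^m times the
reversed sum of `sum_poch_mul_poch_neg` with b = δ-m+1. -/
theorem sum_tri {n m : ℕ} (hm : m < n) (hm0 : 0 < m) (δ : ℂ) (hδ : NotInt δ) :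
    ∑ i ∈ Finset.range (m + 1), (-1) ^ (m - i) / (qfact n (m - i) * ff n (δ - m - i + 1) (m - i)) *
      (1 / (qfact n i * ff n δ i)) = 0 := by
  have hn : n ≠ 0 := by omega
  have hb : NotInt (δ - m + 1) := hδ.add_int (1 - m) (by push_cast; ring)
  have h := sum_poch_mul_poch_neg hm0 hm _ hb
  rw [← Finset.sum_range_reflect] at h
  have h1 := ff_ne_zero hn hδ m
  have h2 := ff_ne_zero hn hb m
  rw [← mul_right_inj' (mul_ne_zero h1 h2), mul_zero, ← mul_zero ((-1 : ℂ) ^ m), ← h,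
    Finset.mul_sum, Finset.mul_sum]
  refine Finset.sum_congr rfl fun i hi => ?_
  rw [Finset.mem_range] at hi
  obtain ⟨l, rfl⟩ : ∃ l, m = i + l := ⟨m - i, by omega⟩
  have e1 : i + l + 1 - 1 - i = l := by omega
  have e2 : i + l - l = i := by omega
  rw [e1, e2, Nat.add_sub_cancel_left]
  have hp : poch n (δ - (i + l : ℕ) + 1) l = ff n (δ - i) l := by
    apply poch_eq_ff; push_cast; ring
  rw [hp, poch_neg, ff_add n δ, ff_add n (δ - (i + l : ℕ) + 1)]
  have e3 : δ - ((i + l : ℕ) : ℂ) + 1 - i = δ - ((i + l : ℕ) : ℂ) - i + 1 := by ring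
  rw [ff_add n δ] at h1
  rw [ff_add, e3] at h2
  rw [e3]
  have g1 := left_ne_zero_of_mul h1
  have g2 := right_ne_zero_of_mul h2
  have g3 : qfact n i ≠ 0 := qfact_ne_zero (by omega)
  have g4 : qfact n l ≠ 0 := qfact_ne_zero (by omega)
  have hsq : ((-1 : ℂ) ^ i) ^ 2 = 1 := by rw [← pow_mul, mul_comm, pow_mul]; simp
  rw [pow_add]
  field_simp
  linear_combination -(ff n (δ - ((i + l : ℕ) : ℂ) + 1) i * ff n (δ - i) l) * hsq

/-- Both matrices are lower triangular, so only k' ≤ w ≤ k contributes, and the sum is that of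
`sum_tri` with δ = γ - 2k'. -/
theorem sum_triInv_mul_tri {n lo hi : ℕ} (hhi : hi < n) (γ : ℂ) (hγ : NotInt γ) {k k' : ℕ}
    (hk : k ∈ Finset.Icc lo hi) (hk' : k' ∈ Finset.Icc lo hi) :
    ∑ w ∈ Finset.Icc lo hi, triInv n γ k w * tri n γ w k' = if k = k' then 1 else 0 := by
  rw [Finset.mem_Icc] at hk hk'
  have hsub : ∑ w ∈ Finset.Icc lo hi, triInv n γ k w * tri n γ w k' =
      ∑ w ∈ Finset.Icc k' k, triInv n γ k w * tri n γ w k' := by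
    symm
    apply Finset.sum_subset
    · exact Finset.Icc_subset_Icc hk'.1 hk.2
    · intro w _ hw
      rw [Finset.mem_Icc, not_and_or] at hw
      rcases hw with hw | hw
      · simp [tri, hw]
      · simp [triInv, hw]
  rw [hsub]
  rcases lt_trichotomy k k' with h | rfl | h
  · rw [Finset.Icc_eq_empty (by omega), if_neg h.ne]; simp
  · simp [tri, triInv, qfact_zero]
  · rw [if_neg h.ne']
    obtain ⟨m, rfl⟩ : ∃ m, k = k' + m := ⟨k - k', by omega⟩
    have h0 := sum_tri (n := n) (m := m) (by omega) (by omega) (γ - 2 * k')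
      (hγ.add_int (-(2 * k')) (by push_cast; ring))
    rw [← h0, ← Finset.Ico_succ_right_eq_Icc, Finset.sum_Ico_eq_sum_range]
    have e : Order.succ (k' + m) - k' = m + 1 := by rw [Nat.succ_eq_succ]; omega
    rw [e]
    refine Finset.sum_congr rfl fun i hi => ?_
    rw [Finset.mem_range] at hi
    rw [triInv, tri, if_pos (by omega), if_pos (by omega)]
    have e1 : k' + m - (k' + i) = m - i := by omega
    have e2 : k' + i - k' = i := by omega
    have e3 : γ - ((k' + m : ℕ) : ℂ) - ((k' + i : ℕ) : ℂ) + 1 = γ - 2 * k' - m - i + 1 := by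
      push_cast; ring
    rw [e1, e2, e3]

/-! ### Module maps and coordinates -/

section Modules

variable {n : ℕ} {M N P : Type*} [AddCommGroup M] [Module ℂ M] [AddCommGroup N] [Module ℂ N]
  [AddCommGroup P] [Module ℂ P]

theorem liftU_gen {A : Type*} [Ring A] [Algebra ℂ A] (e f k k' : A)
    (hc : e * f - f * e = (xi n 1 - (xi n 1)⁻¹)⁻¹ • (k ^ 2 - k' ^ 2))
    (hE : k * e = xi n 1 • (e * k)) (hF : k * f = (xi n 1)⁻¹ • (f * k))
    (h1 : k * k' = 1) (h2 : k' * k = 1) (g : Gen) :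
    liftU n e f k k' hc hE hF h1 h2 (gen n g) = match g with
      | .E => e | .F => f | .K => k | .Kinv => k' := by
  cases g <;> simp [liftU, gen]

theorem rep_E (a : ℂ) : rep n a (gen n .E) = opE n := liftU_gen ..

theorem rep_F (a : ℂ) : rep n a (gen n .F) = opF n a := liftU_gen ..

theorem rep_K (a : ℂ) : rep n a (gen n .K) = opK n a := liftU_gen ..

theorem rep_Kinv (a : ℂ) : rep n a (gen n .Kinv) = opKinv n a := liftU_gen ..

theorem comul_gen (g : Gen) : comul n (gen n g) = match g with
    | .E => gen n .E ⊗ₜ[ℂ] gen n .K + gen n .Kinv ⊗ₜ[ℂ] gen n .E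
    | .F => gen n .F ⊗ₜ[ℂ] gen n .K + gen n .Kinv ⊗ₜ[ℂ] gen n .F
    | .K => gen n .K ⊗ₜ[ℂ] gen n .K
    | .Kinv => gen n .Kinv ⊗ₜ[ℂ] gen n .Kinv := liftU_gen ..

theorem tensorRep_E (ρ : U n →ₐ[ℂ] Module.End ℂ M) (σ : U n →ₐ[ℂ] Module.End ℂ N) :
    tensorRep n ρ σ (gen n .E) = TensorProduct.map (ρ (gen n .E)) (σ (gen n .K)) +
      TensorProduct.map (ρ (gen n .Kinv)) (σ (gen n .E)) := by
  simp [tensorRep, comul_gen, Module.endTensorEndAlgHom_apply]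
  rfl

theorem tensorRep_F (ρ : U n →ₐ[ℂ] Module.End ℂ M) (σ : U n →ₐ[ℂ] Module.End ℂ N) :
    tensorRep n ρ σ (gen n .F) = TensorProduct.map (ρ (gen n .F)) (σ (gen n .K)) +
      TensorProduct.map (ρ (gen n .Kinv)) (σ (gen n .F)) := by
  simp [tensorRep, comul_gen, Module.endTensorEndAlgHom_apply]
  rfl

theorem tensorRep_K (ρ : U n →ₐ[ℂ] Module.End ℂ M) (σ : U n →ₐ[ℂ] Module.End ℂ N) :
    tensorRep n ρ σ (gen n .K) = TensorProduct.map (ρ (gen n .K)) (σ (gen n .K)) := by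
  simp [tensorRep, comul_gen, Module.endTensorEndAlgHom_apply]
  rfl

theorem tensorRep_Kinv (ρ : U n →ₐ[ℂ] Module.End ℂ M) (σ : U n →ₐ[ℂ] Module.End ℂ N) :
    tensorRep n ρ σ (gen n .Kinv) = TensorProduct.map (ρ (gen n .Kinv)) (σ (gen n .Kinv)) := by
  simp [tensorRep, comul_gen, Module.endTensorEndAlgHom_apply]
  rfl

/-- It suffices to check compatibility with the generators. -/
theorem isModuleMap_of_gen (ρ : U n →ₐ[ℂ] Module.End ℂ M) (σ : U n →ₐ[ℂ] Module.End ℂ N)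
    (f : M →ₗ[ℂ] N) (h : ∀ g : Gen, f ∘ₗ ρ (gen n g) = σ (gen n g) ∘ₗ f) :
    IsModuleMap n ρ σ f := by
  suffices H : ∀ x : FreeAlgebra ℂ Gen, ∀ m, f (ρ (RingQuot.mkAlgHom ℂ (Rel n) x) m) =
      σ (RingQuot.mkAlgHom ℂ (Rel n) x) (f m) by
    intro x
    obtain ⟨y, rfl⟩ := RingQuot.mkAlgHom_surjective ℂ (Rel n) x
    exact H y
  intro x
  induction x using FreeAlgebra.induction with
  | grade0 r => intro m; simp [AlgHom.commutes, Module.algebraMap_end_apply]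
  | grade1 g => intro m; exact LinearMap.congr_fun (h g) m
  | mul x y hx hy => intro m; simp [hx, hy]
  | add x y hx hy => intro m; simp [hx, hy]

theorem IsModuleMap.comp {ρ : U n →ₐ[ℂ] Module.End ℂ M} {σ : U n →ₐ[ℂ] Module.End ℂ N}
    {τ : U n →ₐ[ℂ] Module.End ℂ P} {g : N →ₗ[ℂ] P} {f : M →ₗ[ℂ] N}
    (hg : IsModuleMap n σ τ g) (hf : IsModuleMap n ρ σ f) : IsModuleMap n ρ τ (g ∘ₗ f) := by
  intro x m
  simp [hf x m, hg x (f m)]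

theorem IsModuleMap.rTensor {ρ : U n →ₐ[ℂ] Module.End ℂ M} {σ : U n →ₐ[ℂ] Module.End ℂ N}
    {f : M →ₗ[ℂ] N} (hf : IsModuleMap n ρ σ f) (τ : U n →ₐ[ℂ] Module.End ℂ P) :
    IsModuleMap n (tensorRep n ρ τ) (tensorRep n σ τ) (f.rTensor P) := by
  refine isModuleMap_of_gen _ _ _ fun g => TensorProduct.ext' fun x y => ?_
  cases g <;> simp [tensorRep_E, tensorRep_F, tensorRep_K, tensorRep_Kinv, hf _ x]

theorem IsModuleMap.lTensor {ρ : U n →ₐ[ℂ] Module.End ℂ M} {σ : U n →ₐ[ℂ] Module.End ℂ N}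
    {f : M →ₗ[ℂ] N} (hf : IsModuleMap n ρ σ f) (τ : U n →ₐ[ℂ] Module.End ℂ P) :
    IsModuleMap n (tensorRep n τ ρ) (tensorRep n τ σ) (f.lTensor P) := by
  refine isModuleMap_of_gen _ _ _ fun g => TensorProduct.ext' fun x y => ?_
  cases g <;> simp [tensorRep_E, tensorRep_F, tensorRep_K, tensorRep_Kinv, hf _ y]

/-- The coproduct is coassociative: the associator is a map of modules. -/
theorem isModuleMap_assoc (ρ : U n →ₐ[ℂ] Module.End ℂ M) (σ : U n →ₐ[ℂ] Module.End ℂ N)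
    (τ : U n →ₐ[ℂ] Module.End ℂ P) :
    IsModuleMap n (tensorRep n (tensorRep n ρ σ) τ) (tensorRep n ρ (tensorRep n σ τ))
      (TensorProduct.assoc ℂ M N P).toLinearMap := by
  refine isModuleMap_of_gen _ _ _ fun g => TensorProduct.ext_threefold fun x y z => ?_
  cases g <;> simp [tensorRep_E, tensorRep_F, tensorRep_K, tensorRep_Kinv, TensorProduct.add_tmul,
    TensorProduct.tmul_add, add_assoc]

end Modules

/-! ### Coordinates on tensor products and the action of the generators -/

/-- The coordinate of a vector at `e_u`, which is `0` for `u ≥ n`. -/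
noncomputable def coord (n u : ℕ) : V n →ₗ[ℂ] ℂ := ofWt n (fun j => if j = u then 1 else 0)

theorem coord_wt {n : ℕ} (u : ℕ) {j : ℕ} (hj : j < n) :
    coord n u (wt n j) = if j = u then 1 else 0 := ofWt_wt n _ hj

theorem coord_of_le {n u : ℕ} (hu : n ≤ u) : coord n u = 0 :=
  ext_wt fun k hk => by rw [coord_wt u hk, if_neg (by omega)]; rfl

theorem sum_coord_smul_wt {n : ℕ} (x : V n) :
    x = ∑ s ∈ Finset.range n, coord n s x • wt n s := by
  have : LinearMap.id = ∑ s ∈ Finset.range n, (coord n s).smulRight (wt n s) := by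
    refine ext_wt fun k hk => ?_
    simp [LinearMap.sum_apply, coord_wt _ hk, hk]
  simpa [LinearMap.sum_apply] using LinearMap.congr_fun this x

theorem coord_opE (n u : ℕ) (x : V n) : coord n u (opE n x) = qnum n (u + 1) * coord n (u + 1) x := by
  have : coord n u ∘ₗ opE n = qnum n (u + 1) • coord n (u + 1) := by
    refine ext_wt fun k hk => ?_
    rw [LinearMap.comp_apply, opE, ofWt_wt n _ hk, map_smul, coord_wt u (by omega),
      LinearMap.smul_apply, coord_wt _ hk]
    rcases k with _ | k
    · simp [qnum_zero]
    · by_cases h : k = u <;> simp [h]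
  simpa using LinearMap.congr_fun this x

theorem coord_zero_opF (n : ℕ) (a : ℂ) (x : V n) : coord n 0 (opF n a x) = 0 := by
  have : coord n 0 ∘ₗ opF n a = 0 := by
    refine ext_wt fun k hk => ?_
    rw [LinearMap.comp_apply, opF, ofWt_wt n _ hk, map_smul]
    rcases Nat.lt_or_ge (k + 1) n with h | h
    · rw [coord_wt _ h]; simp
    · rw [wt_of_le h]; simp
  simpa using LinearMap.congr_fun this x

theorem coord_succ_opF {n : ℕ} (a : ℂ) {u : ℕ} (hu : u + 1 < n) (x : V n) :
    coord n (u + 1) (opF n a x) = qnum n (2 * a - u) * coord n u x := by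
  have : coord n (u + 1) ∘ₗ opF n a = qnum n (2 * a - u) • coord n u := by
    refine ext_wt fun k hk => ?_
    rw [LinearMap.comp_apply, opF, ofWt_wt n _ hk, map_smul, LinearMap.smul_apply, coord_wt _ hk]
    rcases Nat.lt_or_ge (k + 1) n with h | h
    · rw [coord_wt _ h]
      by_cases h : k = u <;> simp [h]
    · rw [wt_of_le h, if_neg (by omega)]; simp
  simpa using LinearMap.congr_fun this x

theorem coord_opK (n : ℕ) (a : ℂ) (u : ℕ) (x : V n) :
    coord n u (opK n a x) = xi n (a - u) * coord n u x := by
  have : coord n u ∘ₗ opK n a = xi n (a - u) • coord n u := by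
    refine ext_wt fun k hk => ?_
    rw [LinearMap.comp_apply, opK, ofWt_wt n _ hk, map_smul, LinearMap.smul_apply, coord_wt _ hk]
    by_cases h : k = u <;> simp [h]
  simpa using LinearMap.congr_fun this x

theorem coord_opKinv (n : ℕ) (a : ℂ) (u : ℕ) (x : V n) :
    coord n u (opKinv n a x) = xi n (-(a - u)) * coord n u x := by
  have : coord n u ∘ₗ opKinv n a = xi n (-(a - u)) • coord n u := by
    refine ext_wt fun k hk => ?_
    rw [LinearMap.comp_apply, opKinv, ofWt_wt n _ hk, map_smul, LinearMap.smul_apply, coord_wt _ hk]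
    by_cases h : k = u <;> simp [h]
  simpa using LinearMap.congr_fun this x

/-- The tensor product of two linear functionals. -/
noncomputable def tmulFun {M N : Type*} [AddCommGroup M] [Module ℂ M] [AddCommGroup N] [Module ℂ N]
    (φ : M →ₗ[ℂ] ℂ) (ψ : N →ₗ[ℂ] ℂ) : M ⊗[ℂ] N →ₗ[ℂ] ℂ :=
  (TensorProduct.lid ℂ ℂ).toLinearMap ∘ₗ TensorProduct.map φ ψ

@[simp] theorem tmulFun_tmul {M N : Type*} [AddCommGroup M] [Module ℂ M] [AddCommGroup N]
    [Module ℂ N] (φ : M →ₗ[ℂ] ℂ) (ψ : N →ₗ[ℂ] ℂ) (x : M) (y : N) :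
    tmulFun φ ψ (x ⊗ₜ[ℂ] y) = φ x * ψ y := by
  simp [tmulFun]

/-- The coordinate at `e_u ⊗ e_v`. -/
noncomputable def coord₂ (n u v : ℕ) : V n ⊗[ℂ] V n →ₗ[ℂ] ℂ := tmulFun (coord n u) (coord n v)

/-- The coordinate at `e_u ⊗ (e_v ⊗ e_w)`. -/
noncomputable def coord₃ (n u v w : ℕ) : V n ⊗[ℂ] (V n ⊗[ℂ] V n) →ₗ[ℂ] ℂ :=
  tmulFun (coord n u) (coord₂ n v w)

theorem sum_coord₂ {n : ℕ} (x : V n ⊗[ℂ] V n) :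
    x = ∑ u ∈ Finset.range n, ∑ v ∈ Finset.range n, coord₂ n u v x • (wt n u ⊗ₜ[ℂ] wt n v) := by
  induction x with
  | zero => simp
  | add x y hx hy =>
    conv_lhs => rw [hx, hy]
    simp only [map_add, add_smul, Finset.sum_add_distrib]
  | tmul x y =>
    conv_lhs => rw [sum_coord_smul_wt x, sum_coord_smul_wt y, TensorProduct.sum_tmul]
    refine Finset.sum_congr rfl fun u _ => ?_
    rw [TensorProduct.tmul_sum]
    refine Finset.sum_congr rfl fun v _ => ?_
    rw [TensorProduct.smul_tmul_smul, coord₂, tmulFun_tmul]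

theorem ext_coord₂ {n : ℕ} {x y : V n ⊗[ℂ] V n}
    (h : ∀ u < n, ∀ v < n, coord₂ n u v x = coord₂ n u v y) : x = y := by
  rw [sum_coord₂ x, sum_coord₂ y]
  refine Finset.sum_congr rfl fun u hu => Finset.sum_congr rfl fun v hv => ?_
  rw [h u (Finset.mem_range.mp hu) v (Finset.mem_range.mp hv)]

theorem eq_zero_of_coord₃ {n : ℕ} {x : V n ⊗[ℂ] (V n ⊗[ℂ] V n)}
    (h : ∀ u < n, ∀ v < n, ∀ w < n, coord₃ n u v w x = 0) : x = 0 := by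
  have key : ∀ x : V n ⊗[ℂ] (V n ⊗[ℂ] V n), x = ∑ u ∈ Finset.range n, ∑ v ∈ Finset.range n,
      ∑ w ∈ Finset.range n, coord₃ n u v w x • (wt n u ⊗ₜ[ℂ] (wt n v ⊗ₜ[ℂ] wt n w)) := by
    intro x
    induction x with
    | zero => simp
    | add x y hx hy =>
      conv_lhs => rw [hx, hy]
      simp only [map_add, add_smul, Finset.sum_add_distrib]
    | tmul x y =>
      conv_lhs => rw [sum_coord_smul_wt x, sum_coord₂ y, TensorProduct.sum_tmul]
      refine Finset.sum_congr rfl fun u _ => ?_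
      rw [TensorProduct.tmul_sum]
      refine Finset.sum_congr rfl fun v _ => ?_
      rw [TensorProduct.tmul_sum]
      refine Finset.sum_congr rfl fun w _ => ?_
      rw [TensorProduct.smul_tmul_smul, coord₃, tmulFun_tmul]
  rw [key x]
  refine Finset.sum_eq_zero fun u hu => Finset.sum_eq_zero fun v hv =>
    Finset.sum_eq_zero fun w hw => ?_
  rw [h u (Finset.mem_range.mp hu) v (Finset.mem_range.mp hv) w (Finset.mem_range.mp hw), zero_smul]

theorem coord₂_E (n : ℕ) (a b : ℂ) (u v : ℕ) (x : V n ⊗[ℂ] V n) :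
    coord₂ n u v (tensorRep n (rep n a) (rep n b) (gen n .E) x) =
      qnum n (u + 1) * xi n (b - v) * coord₂ n (u + 1) v x +
        xi n (-(a - u)) * qnum n (v + 1) * coord₂ n u (v + 1) x := by
  rw [tensorRep_E, rep_E, rep_E, rep_K, rep_Kinv]
  induction x with
  | zero => simp
  | add x y hx hy => rw [map_add, map_add, hx, hy, map_add, map_add]; ring
  | tmul x y =>
    simp only [coord₂, LinearMap.add_apply, TensorProduct.map_tmul, map_add, tmulFun_tmul,
      coord_opE, coord_opK, coord_opKinv]
    ring

theorem coord₂_K (n : ℕ) (a b : ℂ) (u v : ℕ) (x : V n ⊗[ℂ] V n) :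
    coord₂ n u v (tensorRep n (rep n a) (rep n b) (gen n .K) x) =
      xi n (a + b - u - v) * coord₂ n u v x := by
  rw [tensorRep_K, rep_K, rep_K]
  induction x with
  | zero => simp
  | add x y hx hy => rw [map_add, map_add, hx, hy, map_add]; ring
  | tmul x y =>
    rw [show a + b - (u : ℂ) - v = (a - u) + (b - v) by ring, xi_add]
    simp only [coord₂, TensorProduct.map_tmul, tmulFun_tmul, coord_opK]
    ring

theorem coord₂_Kinv (n : ℕ) (a b : ℂ) (u v : ℕ) (x : V n ⊗[ℂ] V n) :
    coord₂ n u v (tensorRep n (rep n a) (rep n b) (gen n .Kinv) x) =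
      xi n (-(a + b - u - v)) * coord₂ n u v x := by
  rw [tensorRep_Kinv, rep_Kinv, rep_Kinv]
  induction x with
  | zero => simp
  | add x y hx hy => rw [map_add, map_add, hx, hy, map_add]; ring
  | tmul x y =>
    rw [show -(a + b - (u : ℂ) - v) = -(a - u) + -(b - v) by ring, xi_add]
    simp only [coord₂, TensorProduct.map_tmul, tmulFun_tmul, coord_opKinv]
    ring

/-- The cases u = 0 and v = 0 are separate because u - 1 and v - 1 are truncated there. -/
theorem coord₂_F {n : ℕ} (a b : ℂ) {u v : ℕ} (hu : u < n) (hv : v < n) (x : V n ⊗[ℂ] V n) :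
    coord₂ n u v (tensorRep n (rep n a) (rep n b) (gen n .F) x) =
      (if u = 0 then 0 else qnum n (2 * a - u + 1) * xi n (b - v) * coord₂ n (u - 1) v x) +
        (if v = 0 then 0 else
          xi n (-(a - u)) * qnum n (2 * b - v + 1) * coord₂ n u (v - 1) x) := by
  rw [tensorRep_F, rep_F, rep_F, rep_K, rep_Kinv]
  have hF : ∀ (a : ℂ) {u : ℕ} (hu : u < n) (x : V n), coord n u (opF n a x) =
      if u = 0 then 0 else qnum n (2 * a - u + 1) * coord n (u - 1) x := by
    intro a u hu x
    rcases u with _ | u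
    · simp [coord_zero_opF]
    · rw [coord_succ_opF a hu, if_neg (by omega), Nat.add_sub_cancel]
      push_cast
      ring_nf
  induction x with
  | zero => simp
  | add x y hx hy =>
    rw [map_add, map_add, hx, hy, map_add, map_add]
    split_ifs <;> ring
  | tmul x y =>
    simp only [coord₂, LinearMap.add_apply, TensorProduct.map_tmul, map_add, tmulFun_tmul,
      hF _ hu, hF _ hv, coord_opK, coord_opKinv]
    split_ifs <;> ring

theorem coord₃_E (n : ℕ) (a b d : ℂ) (u v w : ℕ) (x : V n ⊗[ℂ] (V n ⊗[ℂ] V n)) :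
    coord₃ n u v w (tensorRep n (rep n a) (tensorRep n (rep n b) (rep n d)) (gen n .E) x) =
      qnum n (u + 1) * xi n (b + d - v - w) * coord₃ n (u + 1) v w x +
        xi n (-(a - u)) * (qnum n (v + 1) * xi n (d - w) * coord₃ n u (v + 1) w x +
        xi n (-(b - v)) * qnum n (w + 1) * coord₃ n u v (w + 1) x) := by
  rw [tensorRep_E]
  induction x with
  | zero => simp
  | add x y hx hy => rw [map_add, map_add, hx, hy, map_add, map_add, map_add]; ring
  | tmul x y =>
    simp only [coord₃, LinearMap.add_apply, TensorProduct.map_tmul, map_add, tmulFun_tmul,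
      coord₂_E, coord₂_K, rep_E, rep_Kinv, coord_opE, coord_opKinv]
    ring

/-! ### Reduction to highest weight vectors -/

/-- A vector killed by `E` is determined by its coordinates at the `e_u ⊗ e_0 ⊗ e_w`. -/
theorem eq_zero_of_E_eq_zero {n : ℕ} (hn : 2 ≤ n) (a b d : ℂ) {x : V n ⊗[ℂ] (V n ⊗[ℂ] V n)}
    (hE : tensorRep n (rep n a) (tensorRep n (rep n b) (rep n d)) (gen n .E) x = 0)
    (h0 : ∀ u < n, ∀ w < n, coord₃ n u 0 w x = 0) : x = 0 := by
  -- The formula for E refers to the indices u + 1 and w + 1, which may equal n; those coordinates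
  -- vanish.
  have hz : ∀ u v w, n ≤ u ∨ n ≤ w → coord₃ n u v w x = 0 := by
    intro u v w h
    have : coord₃ n u v w = 0 := by
      refine TensorProduct.ext' fun y z => ?_
      rcases h with h | h
      · simp [coord₃, coord_of_le h]
      · have : coord₂ n v w = 0 := TensorProduct.ext' fun y z => by simp [coord₂, coord_of_le h]
        simp [coord₃, this]
    rw [this]; rfl
  have key : ∀ v < n, ∀ u w, coord₃ n u v w x = 0 := by
    intro v
    induction v with
    | zero =>
      intro _ u w
      by_cases h : n ≤ u ∨ n ≤ w
      · exact hz u 0 w h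
      · rw [not_or, not_le, not_le] at h
        exact h0 u h.1 w h.2
    -- In the coordinate (u, v, w) of E x = 0, the terms with middle index v vanish by induction,
    -- leaving [v+1] times the coordinate at v + 1, up to a unit.
    | succ v ih =>
      intro hv u w
      have h := coord₃_E n a b d u v w x
      rw [hE, map_zero, ih (by omega), ih (by omega)] at h
      have hq : qnum n ((v : ℂ) + 1) ≠ 0 := by
        have h1 : br n ((v + 1 : ℕ) : ℂ) ≠ 0 := br_natCast_ne_zero (by omega) hv
        have h2 : br n ((1 : ℕ) : ℂ) ≠ 0 := br_natCast_ne_zero (by omega) (by omega)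
        push_cast at h1 h2
        exact div_ne_zero h1 h2
      simpa [hq] using h.symm
  exact eq_zero_of_coord₃ fun u _ v hv w _ => key v hv u w

theorem qnum_ne_zero {n : ℕ} (hn : 2 ≤ n) {x : ℂ} (hx : NotInt x) : qnum n x ≠ 0 := by
  have h2 : br n ((1 : ℕ) : ℂ) ≠ 0 := br_natCast_ne_zero (by omega) (by omega)
  push_cast at h2
  exact div_ne_zero (br_ne_zero (by omega) hx) h2

/-- A module map out of `V^c` is determined by the image of `e_0`. -/
theorem eq_zero_of_map_wt_zero {n : ℕ} (hn : 2 ≤ n) {c : ℂ} (hc : NotHalfInt c) {M : Type*}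
    [AddCommGroup M] [Module ℂ M] {σ : U n →ₐ[ℂ] Module.End ℂ M} {f : V n →ₗ[ℂ] M}
    (hf : IsModuleMap n (rep n c) σ f) (h0 : f (wt n 0) = 0) : f = 0 := by
  refine ext_wt fun k hk => ?_
  induction k with
  | zero => simpa using h0
  | succ k ih =>
    have h := hf (gen n .F) (wt n k)
    rw [rep_F, opF, ofWt_wt n _ (by omega), ih (by omega), map_smul] at h
    have hq : qnum n (2 * c - k) ≠ 0 :=
      qnum_ne_zero hn (hc.two_mul.add_int (-k) (by push_cast; ring))
    simpa [hq] using h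

/-- A sequence of vectors on which `E`, `F`, `K` act as on the basis of `V^c` gives a module map;
the relation for `E` follows from its case on the highest weight vector. -/
theorem isModuleMap_ofWt {n : ℕ} (hn : 2 ≤ n) {c : ℂ} (hc : NotHalfInt c) {M : Type*}
    [AddCommGroup M] [Module ℂ M] {σ : U n →ₐ[ℂ] Module.End ℂ M} (y : ℕ → M)
    (hE : σ (gen n .E) (y 0) = 0) (hyn : y n = 0)
    (hF : ∀ t < n, σ (gen n .F) (y t) = qnum n (2 * c - t) • y (t + 1))
    (hK : ∀ t < n, σ (gen n .K) (y t) = xi n (c - t) • y t)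
    (hKinv : ∀ t < n, σ (gen n .Kinv) (y t) = xi n (-(c - t)) • y t) :
    IsModuleMap n (rep n c) σ (ofWt n y) := by
  have hE' : ∀ t < n, σ (gen n .E) (y t) = qnum n t • y (t - 1) := by
    intro t
    induction t with
    | zero => intro _; simp [hE, qnum_zero]
    | succ t ih =>
      intro ht
      have ih := ih (by omega)
      have hq : qnum n (2 * c - t) ≠ 0 :=
        qnum_ne_zero hn (hc.two_mul.add_int (-t) (by push_cast; ring))
      -- The commutator relation applied to y_t: since F y_t = [2c-t] y_{t+1} with [2c-t] ≠ 0, it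
      -- determines E y_{t+1} from E y_t.
      have hrel := congrArg (fun z => σ z (y t)) (gen_comm n)
      simp only [map_sub, map_mul, map_smul, pow_two, LinearMap.sub_apply,
        Module.End.mul_apply, LinearMap.smul_apply] at hrel
      rw [hF t (by omega), ih, hK t (by omega), hKinv t (by omega), map_smul, map_smul, map_smul,
        map_smul, hK t (by omega), hKinv t (by omega), smul_smul, smul_smul] at hrel
      have hFt : qnum n t • σ (gen n .F) (y (t - 1)) =
          (qnum n t * qnum n (2 * c - t + 1)) • y t := by
        rcases t with _ | t
        · simp [qnum_zero]
        · rw [Nat.add_sub_cancel, hF t (by omega), smul_smul]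
          congr 2
          push_cast
          ring_nf
      rw [hFt, sub_eq_iff_eq_add] at hrel
      rw [← smul_right_inj hq, hrel, ← sub_smul, smul_smul, ← add_smul, smul_smul,
        Nat.add_sub_cancel]
      congr 1
      have hb : br n 1 = xi n 1 - (xi n 1)⁻¹ := by rw [br, xi_neg]
      have h1 : br n 1 ≠ 0 := by
        exact_mod_cast br_natCast_ne_zero (n := n) (j := 1) (by omega) (by omega)
      have h2 : xi n (c - t) * xi n (c - t) - xi n (-(c - t)) * xi n (-(c - t)) =
          br n (2 * (c - t)) := by
        rw [br, ← xi_add, ← xi_add]; ring_nf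
      have h3 : br n 1 * br n (2 * (c - t)) + br n t * br n (2 * c - t + 1) =
          br n (2 * c - t) * br n (t + 1) := by
        simp only [br_mul_br]; ring_nf
      rw [← hb, h2]
      simp only [qnum]
      push_cast
      field_simp
      linear_combination h3
  refine isModuleMap_of_gen _ _ _ fun g => ext_wt fun t ht => ?_
  rw [LinearMap.comp_apply, LinearMap.comp_apply, ofWt_wt n y ht]
  cases g
  · rw [hE' t ht, rep_E, opE, ofWt_wt n _ ht, map_smul, ofWt_wt n y (by omega)]
  · rw [hF t ht, rep_F, opF, ofWt_wt n _ ht, map_smul]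
    rcases Nat.lt_or_ge (t + 1) n with h | h
    · rw [ofWt_wt n y h]
    · rw [wt_of_le h, show t + 1 = n by omega, hyn, map_zero]
  · rw [hK t ht, rep_K, opK, ofWt_wt n _ ht, map_smul, ofWt_wt n y ht]
  · rw [hKinv t ht, rep_Kinv, opKinv, ofWt_wt n _ ht, map_smul, ofWt_wt n y ht]

/-! ### The Clebsch–Gordan maps are module maps -/

theorem qbin_eq_ff {n m : ℕ} {x y : ℂ} (hm : m < n) (h : x - y = m) :
    qbin n x y = ff n x m / qfact n m := by
  have hq := ff_natCast_mul_qfact n 0 m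
  rw [zero_add, qfact_zero, mul_one] at hq
  rw [qbin_of_sub_eq hm h, Finset.prod_div_distrib, h, ← hq]
  rfl

/-- The summand `1 / ({u-z}! {k+z-u}!)`, extended by `0`. -/
noncomputable def invFact (n k u z : ℕ) : ℂ :=
  if z ≤ u ∧ u ≤ k + z then 1 / (qfact n (u - z) * qfact n (k + z - u)) else 0

/-- For u < z the index k + z - u exceeds k: either it is below n and the product contains {0}, or
it is at least n and the binomial is 0 by convention. For u > k + z the difference is negative. -/
theorem qbin_natCast {n k u z : ℕ} {x : ℂ} (hx : x = k) (hk : k < n) :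
    qbin n x ((u : ℂ) - z) = qfact n k * invFact n k u z := by
  subst hx
  rcases Nat.lt_or_ge (k + z) u with h | h
  · rw [invFact, if_neg (by omega), mul_zero]
    refine qbin_of_forall_ne fun m _ hm => ?_
    have : ((k + z : ℕ) : ℂ) = ((m + u : ℕ) : ℂ) := by push_cast; linear_combination hm
    have := Nat.cast_injective this
    omega
  · have hsub : (k : ℂ) - ((u : ℂ) - z) = ((k + z - u : ℕ) : ℂ) := by push_cast [h]; ring
    rcases Nat.lt_or_ge u z with h' | h'
    · rw [invFact, if_neg (by omega), mul_zero]
      rcases Nat.lt_or_ge (k + z - u) n with hn | hn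
      · rw [qbin_eq_ff hn hsub, ff, Finset.prod_eq_zero (i := k), zero_div]
        · rw [Finset.mem_range]; omega
        · simp [br_zero]
      · refine qbin_of_forall_ne fun m hm e => ?_
        rw [hsub] at e
        have := Nat.cast_injective e
        omega
    · rw [qbin_eq_ff (by omega) hsub, invFact, if_pos ⟨h', h⟩]
      have hq := ff_natCast_mul_qfact n (u - z) (k + z - u)
      rw [show u - z + (k + z - u) = k by omega] at hq
      rw [← hq]
      have := qfact_ne_zero (show u - z < n by omega)
      field_simp

/-- The quantum binomial `[x+z; x]`. -/
noncomputable def hbin (n : ℕ) (x : ℂ) (z : ℕ) : ℂ := poch n (x + 1) z / qfact n z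

theorem qbin_add {n z : ℕ} (hz : z < n) (x : ℂ) : qbin n (x + z) x = hbin n x z := by
  rw [qbin_eq_ff hz (by ring), hbin, poch_eq_ff z (by ring : x + z = x + 1 + z - 1)]

@[simp] theorem hbin_zero (n : ℕ) (x : ℂ) : hbin n x 0 = 1 := by simp [hbin, qfact_zero]

theorem br_mul_hbin {n z : ℕ} (hz : z + 1 < n) (x : ℂ) :
    br n (x + 1) * hbin n (x + 1) z = br n (z + 1) * hbin n x (z + 1) := by
  have h1 := qfact_ne_zero (show z < n by omega)
  have h2 : br n ((z + 1 : ℕ) : ℂ) ≠ 0 := br_natCast_ne_zero (by omega) hz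
  push_cast at h2
  rw [hbin, hbin, poch_succ', qfact_succ]
  field_simp

/-- The sum in the Clebsch–Gordan coefficient. -/
noncomputable def cgSum (n : ℕ) (a b c : ℂ) (k u v t : ℕ) : ℂ :=
  ∑ z ∈ Finset.range (t + 1), (-1) ^ z * xi n ((2 * (z : ℂ) - t) * (2 * c - t + 1) / 2) *
    (invFact n k u z * hbin n (2 * a - u) z * hbin n (2 * b - v) (t - z))

/-- The phase in the Clebsch–Gordan coefficient. -/
noncomputable def cgPhase (n : ℕ) (a b : ℂ) (u v : ℕ) : ℂ :=
  (-1) ^ v * xi n ((v * (2 * b - v + 1) - u * (2 * a - u + 1)) / 2)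

theorem cgPhase_succ_left (n : ℕ) (a b : ℂ) (u v : ℕ) :
    cgPhase n a b u v = xi n (a - u) * cgPhase n a b (u + 1) v := by
  rw [cgPhase, cgPhase, mul_left_comm, ← xi_add]
  congr 2
  push_cast
  ring

theorem cgPhase_succ_right (n : ℕ) (a b : ℂ) (u v : ℕ) :
    cgPhase n a b u v = -xi n (-(b - v)) * cgPhase n a b u (v + 1) := by
  rw [cgPhase, cgPhase, pow_succ, show -xi n (-(b - v)) * ((-1) ^ v * -1 *
    xi n ((((v + 1 : ℕ) : ℂ) * (2 * b - ((v + 1 : ℕ) : ℂ) + 1) - u * (2 * a - u + 1)) / 2)) =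
    (-1) ^ v * (xi n (-(b - v)) *
    xi n ((((v + 1 : ℕ) : ℂ) * (2 * b - ((v + 1 : ℕ) : ℂ) + 1) - u * (2 * a - u + 1)) / 2)) by ring,
    ← xi_add]
  congr 2
  push_cast
  ring

/-- The part of the Clebsch–Gordan coefficient that depends on the colors only. -/
noncomputable def cgConst (n : ℕ) (a b c : ℂ) (k : ℕ) : ℂ :=
  Complex.I ^ (c - a - b) * qbin n (2 * c) (a + b + c - (n - 1)) * qfact n k

/-- Separates the factors depending on the colors, on (u, v) and on t, so that the module relations
become relations for `cgSum` alone. -/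
theorem cgqc_eq {n k t : ℕ} {a b c : ℂ} (hk : k < n) (h : a + b - c = k) (ht : t < n) (u v : ℕ) :
    cgqc n a b c u v t = cgConst n a b c k * cgPhase n a b u v * (-1) ^ t *
      (qfact n t / ff n (2 * c) t) * cgSum n a b c k u v t := by
  have hp : (-1 : ℂ) ^ ((v : ℤ) - (t : ℤ)) = (-1) ^ v * (-1) ^ t := by
    rw [zpow_sub₀ (by norm_num), zpow_natCast, zpow_natCast, div_eq_mul_inv, ← inv_pow]
    norm_num
  have hs : ∑ z ∈ Finset.range (t + 1),
      (-1) ^ z * xi n ((2 * (z : ℂ) - (t : ℂ)) * (2 * c - (t : ℂ) + 1) / 2) *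
        qbin n (a + b - c) ((u : ℂ) - (z : ℂ)) *
        qbin n (2 * a - (u : ℂ) + (z : ℂ)) (2 * a - (u : ℂ)) *
        qbin n (2 * b - (v : ℂ) + ((t : ℂ) - (z : ℂ))) (2 * b - (v : ℂ)) =
      qfact n k * cgSum n a b c k u v t := by
    rw [cgSum, Finset.mul_sum]
    refine Finset.sum_congr rfl fun z hz => ?_
    rw [Finset.mem_range] at hz
    rw [qbin_natCast h hk, qbin_add (by omega), ← Nat.cast_sub (by omega), qbin_add (by omega)]
    ring
  rw [cgqc, hs, hp, qbin_eq_ff ht (by ring), cgConst, cgPhase, inv_div]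
  ring

theorem coord₂_Y {n k t u v : ℕ} {a b c : ℂ} (h : a + b - c = k) (ht : t < n) (hu : u < n)
    (hv : v < n) : coord₂ n u v (Y n a b c (wt n t)) =
      if u + v = t + k then cgqc n a b c u v t else 0 := by
  have hiff : ∀ p q : ℕ, ((p : ℂ) + q - t = a + b - c) ↔ p + q = t + k := by
    intro p q
    rw [h, sub_eq_iff_eq_add, ← Nat.cast_add, ← Nat.cast_add, Nat.cast_inj, add_comm k]
  rw [Y, ofWt_wt n _ ht, map_sum, Finset.sum_eq_single_of_mem u (Finset.mem_range.mpr hu),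
    map_sum, Finset.sum_eq_single_of_mem v (Finset.mem_range.mpr hv)]
  · simp only [hiff]
    split_ifs
    · simp [coord₂, coord_wt _ hu, coord_wt _ hv]
    · simp
  · intro q hq hne
    rw [Finset.mem_range] at hq
    split_ifs
    · simp [coord₂, coord_wt _ hq, hne]
    · simp
  · intro p hp hne
    rw [Finset.mem_range] at hp
    rw [map_sum]
    refine Finset.sum_eq_zero fun q _ => ?_
    split_ifs
    · simp [coord₂, coord_wt _ hp, hne]
    · simp

/-- The summand of `cgSum` one step further. -/
noncomputable def cgTerm (n : ℕ) (a b c : ℂ) (k u v t z : ℕ) : ℂ :=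
  (-1) ^ z * xi n ((2 * (z : ℂ) - t) * (2 * c - t + 1) / 2) *
    (invFact n k u z * hbin n (2 * a - u) z * hbin n (2 * b - v) (t - z))

/-- The factor {2a-u+1} raises z by one in the binomial (`br_mul_hbin`), so a shift of the summation
index produces the summands at t + 1, weighted by {z}. -/
theorem cgSum_left {n k u v t : ℕ} (a b c : ℂ) (ht : t < n) (hu : u < n) :
    xi n (c - t) * (if u = 0 then 0 else br n (2 * a - u + 1) * cgSum n a b c k (u - 1) v t) =
      -∑ z ∈ Finset.range (t + 2), xi n (-(t + 1 - z)) * br n z * cgTerm n a b c k u v (t + 1) z := by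
  rcases u with _ | u
  · rw [if_pos rfl, mul_zero, Finset.sum_eq_zero, neg_zero]
    rintro (_ | z) _
    · simp [br_zero]
    · simp [cgTerm, invFact]
  rw [if_neg (by omega), Finset.sum_range_succ', Nat.cast_zero, br_zero, mul_zero, zero_mul,
    add_zero, cgSum, Nat.add_sub_cancel, Finset.mul_sum, Finset.mul_sum, ← Finset.sum_neg_distrib]
  refine Finset.sum_congr rfl fun z hz => ?_
  rw [Finset.mem_range] at hz
  have hT : invFact n k u z = invFact n k (u + 1) (z + 1) := by
    simp only [invFact]
    rw [show u + 1 - (z + 1) = u - z by omega, show k + (z + 1) - (u + 1) = k + z - u by omega]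
    congr 1
    rw [eq_iff_iff]
    omega
  rw [cgTerm, ← hT]
  by_cases hz0 : invFact n k u z = 0
  · simp [hz0]
  -- The support of `invFact` keeps z + 1 below n even when t + 1 = n, so that {z+1} ≠ 0 in
  -- `br_mul_hbin`.
  have hzu : z ≤ u := by
    by_contra h
    exact hz0 (by rw [invFact, if_neg (by omega)])
  have hb := br_mul_hbin (n := n) (z := z) (by omega) (2 * a - ((u + 1 : ℕ) : ℂ))
  have e1 : 2 * a - ((u + 1 : ℕ) : ℂ) + 1 = 2 * a - u := by push_cast; ring
  have hx : xi n (c - t) * xi n ((2 * (z : ℂ) - t) * (2 * c - t + 1) / 2) =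
      xi n (-((t : ℂ) + 1 - ((z + 1 : ℕ) : ℂ))) *
        xi n ((2 * ((z + 1 : ℕ) : ℂ) - ((t + 1 : ℕ) : ℂ)) * (2 * c - ((t + 1 : ℕ) : ℂ) + 1) / 2) := by
    rw [← xi_add, ← xi_add]
    congr 1
    push_cast
    ring
  rw [e1] at hb ⊢
  rw [show t + 1 - (z + 1) = t - z by omega, pow_succ]
  push_cast at hx hb ⊢
  linear_combination ((-1) ^ z * invFact n k u z * hbin n (2 * b - v) (t - z)) *
    (br n (2 * a - u) * hbin n (2 * a - u) z * hx + xi n (-((t : ℂ) + 1 - (z + 1))) *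
      xi n ((2 * ((z : ℂ) + 1) - (t + 1)) * (2 * c - (t + 1) + 1) / 2) * hb)

/-- Here t - z is raised rather than z, so the index is not shifted and the weight is {t+1-z}. -/
theorem cgSum_right {n k u v t : ℕ} (a b c : ℂ) (hv : v < n) (h : u + v = t + 1 + k) :
    xi n (-(c - t)) * (if v = 0 then 0 else br n (2 * b - v + 1) * cgSum n a b c k u (v - 1) t) =
      ∑ z ∈ Finset.range (t + 2), xi n z * br n (t + 1 - z) * cgTerm n a b c k u v (t + 1) z := by
  rcases v with _ | v
  · rw [if_pos rfl, mul_zero, Finset.sum_eq_zero]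
    intro z hz
    rw [Finset.mem_range] at hz
    rcases Nat.lt_or_ge z (t + 1) with h' | h'
    · rw [cgTerm, invFact, if_neg (by omega)]; simp
    · rw [show z = t + 1 by omega]; simp [br_zero]
  rw [if_neg (by omega), Finset.sum_range_succ, show (t : ℂ) + 1 - ((t + 1 : ℕ) : ℂ) = 0 by
    push_cast; ring, br_zero, mul_zero, zero_mul,
    add_zero, cgSum, Nat.add_sub_cancel, Finset.mul_sum, Finset.mul_sum]
  refine Finset.sum_congr rfl fun z hz => ?_
  rw [Finset.mem_range] at hz
  rw [cgTerm]
  by_cases hz0 : invFact n k u z = 0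
  · simp [hz0]
  -- With the weight condition this bounds t - z by the index v of the shifted variable, hence t - z
  -- + 1 < n.
  have hzu : u ≤ k + z := by
    by_contra h
    exact hz0 (by rw [invFact, if_neg (by omega)])
  have hb := br_mul_hbin (n := n) (z := t - z) (by omega) (2 * b - ((v + 1 : ℕ) : ℂ))
  have e1 : 2 * b - ((v + 1 : ℕ) : ℂ) + 1 = 2 * b - v := by push_cast; ring
  have e2 : ((t - z : ℕ) : ℂ) = t - z := Nat.cast_sub (by omega)
  have hx : xi n (-(c - t)) * xi n ((2 * (z : ℂ) - t) * (2 * c - t + 1) / 2) =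
      xi n z * xi n ((2 * (z : ℂ) - ((t + 1 : ℕ) : ℂ)) * (2 * c - ((t + 1 : ℕ) : ℂ) + 1) / 2) := by
    rw [← xi_add, ← xi_add]
    congr 1
    push_cast
    ring
  rw [e1, e2, show (t : ℂ) - z + 1 = t + 1 - z by ring] at hb
  rw [e1, show t + 1 - z = t - z + 1 by omega]
  push_cast at hx hb ⊢
  linear_combination ((-1) ^ z * invFact n k u z * hbin n (2 * a - u) z) *
    (br n (2 * b - v) * hbin n (2 * b - v) (t - z) * hx + xi n z *
      xi n ((2 * (z : ℂ) - (t + 1)) * (2 * c - (t + 1) + 1) / 2) * hb)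

/-- The weights of `cgSum_left` and `cgSum_right` combine by {t+1} = ξ^z {t+1-z} + ξ^{-(t+1-z)} {z}.
-/
theorem cgSum_succ {n k u v t : ℕ} (a b c : ℂ) (ht : t < n) (hu : u < n) (hv : v < n)
    (h : u + v = t + 1 + k) :
    xi n (c - t) * (if u = 0 then 0 else br n (2 * a - u + 1) * cgSum n a b c k (u - 1) v t) -
      xi n (-(c - t)) * (if v = 0 then 0 else br n (2 * b - v + 1) * cgSum n a b c k u (v - 1) t) =
      -(br n (t + 1) * cgSum n a b c k u v (t + 1)) := by
  rw [cgSum_left a b c ht hu, cgSum_right a b c hv h, cgSum, Finset.mul_sum, sub_eq_add_neg,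
    ← neg_add, ← Finset.sum_add_distrib, neg_inj]
  refine Finset.sum_congr rfl fun z _ => ?_
  rw [← add_mul, ← cgTerm]
  congr 1
  simp only [br, mul_sub, ← xi_add]
  ring_nf

/-- On e_0 the two terms of E cancel by the phases of `cgPhase`; the relation for F is `cgSum_succ`;
those for K and K⁻¹ express that weights add. -/
theorem Y_isModuleMap {n k : ℕ} (hn : 2 ≤ n) (hk : k < n) {a b c : ℂ} (hc : NotHalfInt c)
    (h : a + b - c = k) :
    IsModuleMap n (rep n c) (tensorRep n (rep n a) (rep n b)) (Y n a b c) := by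
  have hY : Y n a b c = ofWt n (fun t => Y n a b c (wt n t)) :=
    ext_wt fun t ht => (ofWt_wt n (fun t => Y n a b c (wt n t)) ht).symm
  have hb1 : br n 1 ≠ 0 := by
    exact_mod_cast br_natCast_ne_zero (n := n) (j := 1) (by omega) (by omega)
  rw [hY]
  refine isModuleMap_ofWt hn hc _ ?_ ?_ ?_ ?_ ?_
  · refine ext_coord₂ fun u hu v hv => ?_
    rw [coord₂_E, map_zero]
    by_cases huv : u + 1 + v = k
    · rw [coord₂_Y h (by omega) (by omega) hv, coord₂_Y h (by omega) hu (by omega),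
        if_pos (by omega), if_pos (by omega), cgqc_eq hk h (by omega), cgqc_eq hk h (by omega)]
      have e1 : invFact n k (u + 1) 0 = 1 / (qfact n (u + 1) * qfact n v) := by
        rw [invFact, if_pos (by omega), show k + 0 - (u + 1) = v by omega, Nat.sub_zero]
      have e2 : invFact n k u 0 = 1 / (qfact n u * qfact n (v + 1)) := by
        rw [invFact, if_pos (by omega), show k + 0 - u = v + 1 by omega, Nat.sub_zero]
      have p1 := cgPhase_succ_left n a b u v
      have p2 := cgPhase_succ_right n a b u v
      have q1 : xi n (a - u) ≠ 0 := xi_ne_zero _ _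
      have q2 : xi n (b - v) ≠ 0 := xi_ne_zero _ _
      have g1 := qfact_ne_zero (show u + 1 < n by omega)
      have g2 := qfact_ne_zero (show v + 1 < n by omega)
      rw [qfact_succ] at g1 g2
      have g11 := left_ne_zero_of_mul g1
      have g12 := right_ne_zero_of_mul g1
      have g21 := left_ne_zero_of_mul g2
      have g22 := right_ne_zero_of_mul g2
      simp only [cgSum, zero_add, Finset.sum_range_one, e1, e2, Nat.sub_self, hbin_zero, qfact_succ, qnum,
        xi_neg] at p2 ⊢
      have p1' : cgPhase n a b (u + 1) v = (xi n (a - u))⁻¹ * cgPhase n a b u v := by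
        rw [p1]; field_simp
      have p2' : cgPhase n a b u (v + 1) = -xi n (b - v) * cgPhase n a b u v := by
        rw [p2]; field_simp
      rw [p1', p2']
      field_simp
      ring
    · have hz : ∀ p q, p + q ≠ k → coord₂ n p q (Y n a b c (wt n 0)) = 0 := by
        intro p q hpq
        rcases Nat.lt_or_ge p n with hp | hp
        · rcases Nat.lt_or_ge q n with hq | hq
          · rw [coord₂_Y h (by omega) hp hq, if_neg (by omega)]
          · rw [show coord₂ n p q = 0 from TensorProduct.ext' fun y z => by
              simp [coord₂, coord_of_le hq]]; rfl
        · rw [show coord₂ n p q = 0 from TensorProduct.ext' fun y z => by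
            simp [coord₂, coord_of_le hp]]; rfl
      rw [hz _ _ (by omega), hz _ _ (by omega)]
      simp
  · rw [wt_of_le le_rfl, map_zero]
  · intro t ht
    refine ext_coord₂ fun u hu v hv => ?_
    rw [coord₂_F a b hu hv, map_smul, smul_eq_mul]
    have hct : NotInt (2 * c - t) := hc.two_mul.add_int (-t) (by push_cast; ring)
    have hbt : br n (2 * c - t) ≠ 0 := br_ne_zero (by omega) hct
    have hft := ff_ne_zero (n := n) (by omega) hc.two_mul t
    by_cases huv : u + v = t + 1 + k
    · have hS := cgSum_succ (k := k) a b c ht hu hv huv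
      have hcc : c - t = a + b - u - v + 1 := by
        have : (u : ℂ) + v = t + 1 + k := by exact_mod_cast huv
        linear_combination -h + this
      have L1 : (if u = 0 then 0 else qnum n (2 * a - u + 1) * xi n (b - v) *
          coord₂ n (u - 1) v (Y n a b c (wt n t))) =
          cgConst n a b c k * cgPhase n a b u v * (-1) ^ t * (qfact n t / ff n (2 * c) t) / br n 1 *
          (xi n (c - t) * if u = 0 then 0 else
            br n (2 * a - u + 1) * cgSum n a b c k (u - 1) v t) := by
        rcases u with _ | u
        · simp
        · rw [if_neg (by omega), if_neg (by omega), Nat.add_sub_cancel,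
            coord₂_Y h ht (by omega) hv, if_pos (by omega), cgqc_eq hk h ht,
            cgPhase_succ_left, hcc, qnum]
          rw [show a + b - ((u + 1 : ℕ) : ℂ) - v + 1 = (a - u) + (b - v) by push_cast; ring, xi_add]
          ring
      have L2 : (if v = 0 then 0 else xi n (-(a - u)) * qnum n (2 * b - v + 1) *
          coord₂ n u (v - 1) (Y n a b c (wt n t))) =
          -(cgConst n a b c k * cgPhase n a b u v * (-1) ^ t * (qfact n t / ff n (2 * c) t) / br n 1 *
          (xi n (-(c - t)) * if v = 0 then 0 else
            br n (2 * b - v + 1) * cgSum n a b c k u (v - 1) t)) := by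
        rcases v with _ | v
        · simp
        · rw [if_neg (by omega), if_neg (by omega), Nat.add_sub_cancel,
            coord₂_Y h ht hu (by omega), if_pos (by omega), cgqc_eq hk h ht,
            cgPhase_succ_right, hcc, qnum]
          rw [show -(a + b - u - ((v + 1 : ℕ) : ℂ) + 1) = -(a - u) + -(b - v) by push_cast; ring,
            xi_add]
          ring
      rw [L1, L2, ← sub_eq_add_neg, ← mul_sub, hS]
      rcases Nat.lt_or_ge (t + 1) n with h1 | h1
      · rw [coord₂_Y h h1 hu hv, if_pos (by omega), cgqc_eq hk h h1, qfact_succ, ff_succ, qnum,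
          pow_succ]
        field_simp
      -- At the last weight vector F must give 0, and the recurrence does so because its factor
      -- {t+1} is {n} = 0.
      · have : (t : ℂ) + 1 = n := by exact_mod_cast (show t + 1 = n by omega)
        rw [this, br_natCast_self, wt_of_le h1]
        simp
    · have hR : coord₂ n u v (Y n a b c (wt n (t + 1))) = 0 := by
        rcases Nat.lt_or_ge (t + 1) n with h1 | h1
        · rw [coord₂_Y h h1 hu hv, if_neg (by omega)]
        · rw [wt_of_le h1]; simp
      rw [hR, mul_zero]
      have L1 : u ≠ 0 → coord₂ n (u - 1) v (Y n a b c (wt n t)) = 0 := fun h0 => by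
        rw [coord₂_Y h ht (by omega) hv, if_neg (by omega)]
      have L2 : v ≠ 0 → coord₂ n u (v - 1) (Y n a b c (wt n t)) = 0 := fun h0 => by
        rw [coord₂_Y h ht hu (by omega), if_neg (by omega)]
      split_ifs with h1 h2 h2
      · simp
      · simp [L2 h2]
      · simp [L1 h1]
      · simp [L1 h1, L2 h2]
  · intro t ht
    refine ext_coord₂ fun u hu v hv => ?_
    rw [coord₂_K, map_smul, smul_eq_mul, coord₂_Y h ht hu hv]
    split_ifs with huv
    · have : (u : ℂ) + v = t + k := by exact_mod_cast huv
      rw [show a + b - u - v = c - t by linear_combination h - this]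
    · simp
  · intro t ht
    refine ext_coord₂ fun u hu v hv => ?_
    rw [coord₂_Kinv, map_smul, smul_eq_mul, coord₂_Y h ht hu hv]
    split_ifs with huv
    · have : (u : ℂ) + v = t + k := by exact_mod_cast huv
      rw [show a + b - u - v = c - t by linear_combination h - this]
    · simp

/-! ### The two inclusions in the coordinates at `e_u ⊗ e_0 ⊗ e_w` -/

theorem cgqc_zero {n k : ℕ} {a b c : ℂ} (hk : k < n) (h : a + b - c = k) {u v : ℕ}
    (huv : u + v = k) : cgqc n a b c u v 0 =
      cgConst n a b c k * cgPhase n a b u v / (qfact n u * qfact n v) := by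
  have e : invFact n k u 0 = 1 / (qfact n u * qfact n v) := by
    rw [invFact, if_pos (by omega), show k + 0 - u = v by omega, Nat.sub_zero]
  rw [cgqc_eq hk h (by omega), cgSum, zero_add, Finset.sum_range_one, e]
  simp [qfact_zero, xi_zero]
  ring

/-- With second index 0, weight forces first index k + s, and `invFact` then leaves only z = s. -/
theorem cgqc_right_zero {n k s : ℕ} {a b c : ℂ} (hk : k < n) (h : a + b - c = k) (hs : s < n) :
    cgqc n a b c (k + s) 0 s = cgConst n a b c k * cgPhase n a b (k + s) 0 *
      xi n (s * (2 * c - s + 1) / 2) * ff n (2 * a - k) s / (ff n (2 * c) s * qfact n k) := by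
  have e : invFact n k (k + s) s = 1 / qfact n k := by
    rw [invFact, if_pos (by omega), Nat.sub_self, Nat.add_sub_cancel, qfact_zero, mul_one]
  have h1 := qfact_ne_zero hs
  have hsq : ((-1 : ℂ) ^ s) ^ 2 = 1 := by rw [← pow_mul, mul_comm, pow_mul]; simp
  rw [cgqc_eq hk h hs, cgSum, Finset.sum_range_succ, Finset.sum_eq_zero, e, Nat.sub_self,
    hbin_zero, hbin, poch_eq_ff (y := 2 * a - k) s (by push_cast; ring),
    show (2 * (s : ℂ) - s) = s by ring]
  · field_simp
    linear_combination (cgConst n a b c k * cgPhase n a b (k + s) 0 *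
      xi n (s * (2 * c - s + 1) / 2) * ff n (2 * a - k) s / (ff n (2 * c) s * qfact n k)) * hsq
  · intro z hz
    rw [Finset.mem_range] at hz
    rw [invFact, if_neg (by omega)]
    simp

/-- With first index 0, `invFact` leaves only z = 0. -/
theorem cgqc_left_zero {n k s : ℕ} {a b c : ℂ} (hk : k < n) (h : a + b - c = k) (hs : s < n) :
    cgqc n a b c 0 (k + s) s = cgConst n a b c k * cgPhase n a b 0 (k + s) * (-1) ^ s *
      xi n (-(s * (2 * c - s + 1) / 2)) * ff n (2 * b - k) s / (ff n (2 * c) s * qfact n k) := by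
  have e : invFact n k 0 0 = 1 / qfact n k := by
    rw [invFact, if_pos (by omega), Nat.sub_self, Nat.sub_zero, qfact_zero, one_mul, Nat.add_zero]
  have h1 := qfact_ne_zero hs
  rw [cgqc_eq hk h hs, cgSum, Finset.sum_range_succ', Finset.sum_eq_zero, e, Nat.sub_zero,
    hbin_zero, hbin, poch_eq_ff (y := 2 * b - k) s (by push_cast; ring), pow_zero,
    show ((2 * ((0 : ℕ) : ℂ) - s) * (2 * c - s + 1) / 2) = -(s * (2 * c - s + 1) / 2) by
      push_cast; ring]
  · field_simp
    ring
  · intro z _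
    rw [invFact, if_neg (by omega)]
    simp

theorem coord₂_tmul {n : ℕ} (u v : ℕ) (x y : V n) :
    coord₂ n u v (x ⊗ₜ[ℂ] y) = coord n u x * coord n v y := tmulFun_tmul _ _ x y

theorem coord₃_assoc_rTensor {n : ℕ} (u v w : ℕ) (g : V n →ₗ[ℂ] V n ⊗[ℂ] V n)
    (y : V n ⊗[ℂ] V n) :
    coord₃ n u v w (TensorProduct.assoc ℂ (V n) (V n) (V n) (g.rTensor (V n) y)) =
      ∑ s ∈ Finset.range n, coord₂ n s w y * coord₂ n u v (g (wt n s)) := by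
  induction y with
  | zero => simp
  | add x y hx hy => simp only [map_add, hx, hy, add_mul, Finset.sum_add_distrib]
  | tmul x y =>
    have h : ∀ z : V n ⊗[ℂ] V n, coord₃ n u v w (TensorProduct.assoc ℂ _ _ _ (z ⊗ₜ[ℂ] y)) =
        coord₂ n u v z * coord n w y := by
      intro z
      induction z with
      | zero => simp
      | add x y hx hy => rw [TensorProduct.add_tmul, map_add, map_add, hx, hy, map_add, add_mul]
      | tmul p q => simp [coord₃, coord₂, mul_assoc]
    rw [LinearMap.rTensor_tmul, h]
    conv_lhs => rw [sum_coord_smul_wt x]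
    rw [map_sum, map_sum, Finset.sum_mul]
    refine Finset.sum_congr rfl fun s _ => ?_
    rw [map_smul, map_smul, smul_eq_mul, coord₂_tmul]
    ring

theorem coord₃_lTensor {n : ℕ} (u v w : ℕ) (g : V n →ₗ[ℂ] V n ⊗[ℂ] V n) (y : V n ⊗[ℂ] V n) :
    coord₃ n u v w (g.lTensor (V n) y) =
      ∑ s ∈ Finset.range n, coord₂ n u s y * coord₂ n v w (g (wt n s)) := by
  induction y with
  | zero => simp
  | add x y hx hy => simp only [map_add, hx, hy, add_mul, Finset.sum_add_distrib]
  | tmul x y =>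
    rw [LinearMap.lTensor_tmul, coord₃, tmulFun_tmul]
    conv_lhs => rw [sum_coord_smul_wt y]
    rw [map_sum, map_sum, Finset.mul_sum]
    refine Finset.sum_congr rfl fun s _ => ?_
    rw [map_smul, map_smul, smul_eq_mul, coord₂_tmul]
    ring

/-- The factor common to both inclusions at `e_u ⊗ e_0 ⊗ e_w`. -/
noncomputable def slicePhase (n : ℕ) (a b d c : ℂ) (u w : ℕ) : ℂ :=
  Complex.I ^ (c - a - b - d) *
    ((-1) ^ w * xi n ((w * (2 * d - w + 1) - u * (2 * a - u + 1)) / 2)) *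
    (ff n (2 * d) w / qfact n u)

theorem slicePhase_ne_zero {n : ℕ} (hn : n ≠ 0) (a b c : ℂ) {d : ℂ} (hd : NotHalfInt d) {u w : ℕ}
    (hu : u < n) : slicePhase n a b d c u w ≠ 0 := by
  have h1 := ff_ne_zero hn hd.two_mul w
  have h2 := qfact_ne_zero hu
  have h3 : Complex.I ^ (c - a - b - d) ≠ 0 := by
    rw [Ne, Complex.cpow_eq_zero_iff]
    simp
  simp [slicePhase, h1, h2, h3]

/-- The left inclusion at `e_u ⊗ e_0 ⊗ e_w`, up to `slicePhase`. -/
noncomputable def leftCoef (n : ℕ) (a e d c : ℂ) (k₀ t u w : ℕ) : ℂ :=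
  if w ≤ t then
    (qbin n (2 * e) (2 * e - (n - 1 - k₀ : ℕ)) * qbin n (2 * c) (2 * c - (n - 1 - t : ℕ)) *
      qfact n t) * (qfact n u / (ff n (2 * d) w * qfact n w) *
      (ff n (2 * a - k₀) (t - w) / (qfact n (t - w) * ff n (2 * e) (t - w))))
  else 0

/-- The diagonal factor of the right inclusions at `e_u ⊗ e_0 ⊗ e_w`. -/
noncomputable def rightCoef (n : ℕ) (d f c : ℂ) (k k' : ℕ) : ℂ :=
  qbin n (2 * f) (2 * f - (n - 1 - k : ℕ)) * qbin n (2 * c) (2 * c - (n - 1 - k' : ℕ)) *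
    qfact n k' / ff n (2 * d) k

theorem cgConst_eq {n k : ℕ} (hk : k < n) {a b c : ℂ} (h : a + b - c = k) : cgConst n a b c k =
    Complex.I ^ (c - a - b) * qbin n (2 * c) (2 * c - (n - 1 - k : ℕ)) * qfact n k := by
  have : ((n - 1 - k : ℕ) : ℂ) = n - 1 - k := by
    rw [Nat.cast_sub (by omega), Nat.cast_sub (by omega), Nat.cast_one]
  rw [cgConst, this, show a + b + c - ((n : ℂ) - 1) = 2 * c - (n - 1 - k) by linear_combination h]

/-- By weight, the intermediate index can only be s = t - w, and both coefficients there are single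
products. The phases involving e cancel, as do the exponents of √-1, which is why `slicePhase` is
free of the intermediate color. -/
theorem leftIncl_coord {n : ℕ} (hn : 2 ≤ n) {a b e d c : ℂ} {k₀ t : ℕ} (hk₀ : k₀ < n) (ht : t < n)
    (h₁ : a + b - e = k₀) (h₂ : e + d - c = t) (he : NotHalfInt e) (hd : NotHalfInt d)
    {u w : ℕ} (hu : u < n) (hw : w < n) :
    coord₃ n u 0 w (leftIncl n a b d c e (wt n 0)) =
      if u + w = k₀ + t then slicePhase n a b d c u w * leftCoef n a e d c k₀ t u w else 0 := by
  have hsum : coord₃ n u 0 w (leftIncl n a b d c e (wt n 0)) = ∑ s ∈ Finset.range n,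
      (if s + w = 0 + t then cgqc n e d c s w 0 else 0) *
        (if u + 0 = s + k₀ then cgqc n a b e u 0 s else 0) := by
    have := coord₃_assoc_rTensor u 0 w (Y n a b e) (Y n e d c (wt n 0))
    rw [leftIncl, LinearMap.comp_apply, LinearMap.comp_apply]
    refine this.trans (Finset.sum_congr rfl fun s hs => ?_)
    rw [Finset.mem_range] at hs
    rw [coord₂_Y h₂ (by omega) hs hw, coord₂_Y h₁ hs hu (by omega)]
  rw [hsum]
  by_cases hc1 : w ≤ t ∧ u + w = k₀ + t
  · obtain ⟨hwt, huw⟩ := hc1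
    obtain ⟨s, rfl⟩ : ∃ s, t = s + w := ⟨t - w, by omega⟩
    obtain rfl : u = k₀ + s := by omega
    rw [Finset.sum_eq_single_of_mem s (Finset.mem_range.mpr (by omega)), if_pos (by omega),
      if_pos (by omega), if_pos huw, leftCoef, if_pos hwt]
    · rw [Nat.add_sub_cancel, cgqc_zero ht h₂ rfl, cgqc_right_zero hk₀ h₁ (by omega),
        cgConst_eq hk₀ h₁, cgConst_eq ht h₂, slicePhase, cgPhase, cgPhase]
      have hI : Complex.I ^ (c - a - b - d) =
          Complex.I ^ (c - e - d) * Complex.I ^ (e - a - b) := by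
        rw [← Complex.cpow_add _ _ Complex.I_ne_zero]
        congr 1
        ring
      have hx : xi n ((w * (2 * d - w + 1) -
            ((k₀ + s : ℕ) : ℂ) * (2 * a - ((k₀ + s : ℕ) : ℂ) + 1)) / 2) =
          xi n ((w * (2 * d - w + 1) - s * (2 * e - s + 1)) / 2) *
          xi n ((((0 : ℕ) : ℂ) * (2 * b - ((0 : ℕ) : ℂ) + 1) -
            ((k₀ + s : ℕ) : ℂ) * (2 * a - ((k₀ + s : ℕ) : ℂ) + 1)) / 2) *
          xi n (s * (2 * e - s + 1) / 2) := by
        rw [← xi_add, ← xi_add]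
        congr 1
        push_cast
        ring
      rw [hI, hx]
      have g1 := ff_ne_zero (n := n) (by omega) hd.two_mul w
      have g2 := ff_ne_zero (n := n) (by omega) he.two_mul s
      have g3 := qfact_ne_zero hu
      have g4 := qfact_ne_zero hk₀
      have g5 := qfact_ne_zero (show s < n by omega)
      have g6 := qfact_ne_zero hw
      generalize ff n (2 * d) w = x₁ at g1 ⊢
      generalize ff n (2 * e) s = x₂ at g2 ⊢
      field_simp
    · intro r _ hr
      rw [if_neg (by omega), zero_mul]
  · rw [Finset.sum_eq_zero]
    · split_ifs with h
      · rw [leftCoef, if_neg (by omega), mul_zero]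
      · rfl
    · intro r _
      split_ifs <;> first | omega | simp

/-- As on the left, with the only intermediate index s = w - k. The condition k ≤ w makes the
dependence on w triangular; γ = 2(b+d) enters because γ - 2k = 2f. -/
theorem rightIncl_coord {n : ℕ} (hn : 2 ≤ n) {a b f d c : ℂ} {k k' : ℕ} (hk : k < n) (hk' : k' < n)
    (h₁ : b + d - f = k) (h₂ : a + f - c = k') (hf : NotHalfInt f) (hd : NotHalfInt d)
    {u w : ℕ} (hu : u < n) (hw : w < n) :
    coord₃ n u 0 w (rightIncl n a b d c f (wt n 0)) =
      if u + w = k + k' then slicePhase n a b d c u w *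
        (rightCoef n d f c k k' * tri n (2 * (b + d)) w k) else 0 := by
  have hsum : coord₃ n u 0 w (rightIncl n a b d c f (wt n 0)) = ∑ s ∈ Finset.range n,
      (if u + s = 0 + k' then cgqc n a f c u s 0 else 0) *
        (if 0 + w = s + k then cgqc n b d f 0 w s else 0) := by
    have := coord₃_lTensor u 0 w (Y n b d f) (Y n a f c (wt n 0))
    rw [rightIncl, LinearMap.comp_apply]
    refine this.trans (Finset.sum_congr rfl fun s hs => ?_)
    rw [Finset.mem_range] at hs
    rw [coord₂_Y h₂ (by omega) hu hs, coord₂_Y h₁ hs (by omega) hw]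
  rw [hsum]
  by_cases hc1 : k ≤ w ∧ u + w = k + k'
  · obtain ⟨hwt, huw⟩ := hc1
    obtain ⟨s, rfl⟩ : ∃ s, w = k + s := ⟨w - k, by omega⟩
    obtain rfl : k' = u + s := by omega
    rw [Finset.sum_eq_single_of_mem s (Finset.mem_range.mpr (by omega)), if_pos (by omega),
      if_pos (by omega), if_pos huw, tri, if_pos hwt]
    · rw [Nat.add_sub_cancel_left, cgqc_zero hk' h₂ rfl, cgqc_left_zero hk h₁ (by omega),
        cgConst_eq hk h₁, cgConst_eq hk' h₂, slicePhase, cgPhase, cgPhase, rightCoef]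
      have hI : Complex.I ^ (c - a - b - d) =
          Complex.I ^ (c - a - f) * Complex.I ^ (f - b - d) := by
        rw [← Complex.cpow_add _ _ Complex.I_ne_zero]
        congr 1
        ring
      have hx : xi n ((((k + s : ℕ) : ℂ) * (2 * d - ((k + s : ℕ) : ℂ) + 1) -
            u * (2 * a - u + 1)) / 2) =
          xi n ((s * (2 * f - s + 1) - u * (2 * a - u + 1)) / 2) *
          xi n ((((k + s : ℕ) : ℂ) * (2 * d - ((k + s : ℕ) : ℂ) + 1) -
            ((0 : ℕ) : ℂ) * (2 * b - ((0 : ℕ) : ℂ) + 1)) / 2) *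
          xi n (-(s * (2 * f - s + 1) / 2)) := by
        rw [← xi_add, ← xi_add]
        congr 1
        push_cast
        ring
      have hf2 : 2 * (b + d) - 2 * (k : ℂ) = 2 * f := by linear_combination 2 * h₁
      rw [hI, hx, hf2, ff_add]
      have hsq : ((-1 : ℂ) ^ s) ^ 2 = 1 := by rw [← pow_mul, mul_comm, pow_mul]; simp
      have g1 := ff_ne_zero (n := n) (by omega) hd.two_mul k
      have g2 := ff_ne_zero (n := n) (by omega) hf.two_mul s
      have g3 := qfact_ne_zero hu
      have g4 := qfact_ne_zero hk
      have g5 := qfact_ne_zero (show s < n by omega)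
      generalize ff n (2 * d) k = x₁ at g1 ⊢
      generalize ff n (2 * f) s = x₂ at g2 ⊢
      field_simp
      rw [hsq, mul_one]
    · intro r _ hr
      rw [if_neg (by omega), zero_mul]
  · rw [Finset.sum_eq_zero]
    · split_ifs with h
      · rw [tri, if_neg (by omega), mul_zero, mul_zero]
      · rfl
    · intro r _
      split_ifs <;> first | omega | simp

/-! ### Existence, uniqueness and the closed formula -/

/-- A left inverse of a finite square matrix is also a right inverse, so the explicit candidate both
solves the system and is the only solution. -/
theorem solve_of_leftInverse (s : Finset ℕ) (R L : ℕ → ℕ → ℂ)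
    (h : ∀ k ∈ s, ∀ k' ∈ s, ∑ w ∈ s, L k w * R w k' = if k = k' then 1 else 0) (x l : ℕ → ℂ) :
    (∀ w ∈ s, l w = ∑ k ∈ s, x k * R w k) ↔ ∀ k ∈ s, x k = ∑ w ∈ s, L k w * l w := by
  let R' : Matrix s s ℂ := fun w k => R w k
  let L' : Matrix s s ℂ := fun k w => L k w
  have h1 : L' * R' = 1 := by
    ext k k'
    rw [Matrix.mul_apply, Matrix.one_apply, Finset.sum_coe_sort s (fun w => L k w * R w k'),
      h k k.2 k' k'.2]
    simp only [Subtype.ext_iff]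
  have h2 : R' * L' = 1 := mul_eq_one_comm.mp h1
  have e1 : (∀ w ∈ s, l w = ∑ k ∈ s, x k * R w k) ↔
      (fun w : s => l w) = R'.mulVec (fun k : s => x k) := by
    rw [funext_iff, Subtype.forall]
    refine forall₂_congr fun w hw => ?_
    rw [Matrix.mulVec, dotProduct, Finset.sum_coe_sort s (fun k => R w k * x k)]
    rw [Finset.sum_congr rfl fun k _ => mul_comm (x k) (R w k)]
  have e2 : (∀ k ∈ s, x k = ∑ w ∈ s, L k w * l w) ↔
      (fun k : s => x k) = L'.mulVec (fun w : s => l w) := by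
    rw [funext_iff, Subtype.forall]
    refine forall₂_congr fun w hw => ?_
    rw [Matrix.mulVec, dotProduct, Finset.sum_coe_sort s (fun k => L w k * l k)]
  rw [e1, e2]
  constructor <;> intro h <;> rw [h, Matrix.mulVec_mulVec] <;> simp [h1, h2]

theorem channels_eq {n N : ℕ} (hn : n ≠ 0) {a b d c : ℂ} (hN : a + b + d - c = N) :
    channels n a b d c =
      (Finset.Icc (N - (n - 1)) (min N (n - 1))).image (fun k : ℕ => b + d - k) := by
  ext x
  simp only [channels, Finset.mem_filter, Finset.mem_image, Finset.mem_range, Finset.mem_Icc]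
  constructor
  · rintro ⟨⟨k, hk, rfl⟩, k', hk', h⟩
    have : k + k' = N := by
      have : ((k + k' : ℕ) : ℂ) = N := by push_cast; linear_combination hN - h
      exact_mod_cast this
    exact ⟨k, by omega, rfl⟩
  · rintro ⟨k, hk, rfl⟩
    refine ⟨⟨k, by omega, rfl⟩, N - k, by omega, ?_⟩
    rw [Nat.cast_sub (by omega)]
    linear_combination hN

theorem NotHalfInt.add_int {x y : ℂ} (hx : NotHalfInt x) (k : ℤ) (h : y = x + k) :
    NotHalfInt y := by
  rintro l hl
  exact hx (l - 2 * k) (by push_cast; linear_combination hl - h)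

/-- Each factor changes sign under a shift by n, as ξ^n = -1. -/
theorem ff_add_self {n : ℕ} (hn : n ≠ 0) (x : ℂ) (m : ℕ) :
    ff n (x + n) m = (-1) ^ m * ff n x m := by
  induction m with
  | zero => simp
  | succ m ih =>
    rw [ff_succ, ff_succ, ih, show x + (n : ℂ) - m = x - m + n by ring, br_add_self hn, pow_succ]
    ring

/-- The complementary form of a quantum binomial at the root of unity. -/
theorem qbin_compl {n k : ℕ} (hk : k < n) {x : ℂ} (hx : NotInt x) :
    qbin n x (x - (n - 1 - k : ℕ)) =
      ff n x (n - 1) / qfact n (n - 1) * ((-1) ^ k * qfact n k / ff n (x + 1 + k) k) := by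
  have hn : n ≠ 0 := by omega
  obtain ⟨l, rfl⟩ : ∃ l, n = k + l + 1 := ⟨n - 1 - k, by omega⟩
  rw [show k + l + 1 - 1 - k = l by omega, qbin_eq_ff (m := l) (by omega) (by ring),
    show k + l + 1 - 1 = l + k by omega, ff_add]
  have h1 : ff (k + l + 1) (x + 1 + k) k = (-1) ^ k * ff (k + l + 1) (x - l) k := by
    rw [← ff_add_self hn]
    congr 1
    push_cast
    ring
  -- {n-j} = {j} at this root of unity, so {n-1}! splits as {l}! {k}! for k + l = n - 1.
  have h2 : qfact (k + l + 1) (l + k) = qfact (k + l + 1) l * qfact (k + l + 1) k := by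
    rw [qfact_add, poch_eq_ff (y := ((k + l : ℕ) : ℂ)) k (by push_cast; ring)]
    have h3 := ff_add_self hn (-1) k
    rw [show (-1 : ℂ) + ((k + l + 1 : ℕ) : ℂ) = ((k + l : ℕ) : ℂ) by push_cast; ring] at h3
    have h4 := poch_neg (k + l + 1) (-1) k
    have h5 := qfact_add (k + l + 1) 0 k
    rw [qfact_zero, one_mul, zero_add, Nat.cast_zero, zero_add] at h5
    rw [neg_neg, ← h5] at h4
    rw [h3, ← h4]
  have g1 := ff_ne_zero hn (hx.add_int (-l) (y := x - l) (by push_cast; ring)) k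
  have g2 := qfact_ne_zero (show l < k + l + 1 by omega)
  have g3 := qfact_ne_zero (show k < k + l + 1 by omega)
  rw [h1, h2]
  field_simp

theorem qbin_add_self {n : ℕ} (hn : n ≠ 0) (x : ℂ) :
    qbin n (x + n) (x + 1) = (-1) ^ (n - 1) * (ff n x (n - 1) / qfact n (n - 1)) := by
  have h : ((n - 1 : ℕ) : ℂ) = n - 1 := by rw [Nat.cast_sub (by omega), Nat.cast_one]
  rw [qbin_eq_ff (m := n - 1) (by omega) (by rw [h]; ring), ff_add_self hn, mul_div_assoc]

/-! ### The solution as a balanced series -/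

/-- The summand of the closed formula, as a summand of the left side of `sears`. -/
theorem closed_summand {n k k' k₀ t z : ℕ} (hk : k < n) (hk' : k' < n) (ht : t < n)
    (hN : k + k' = k₀ + t) {a b c d : ℂ} (hc : NotInt (2 * c)) (hd : NotInt (2 * d)) (hzt : z ≤ t) :
    (if t ≤ k + z ∧ z ≤ k' then
      (-1) ^ z * (ff n (2 * c + k' + 1) (k' - z) / qfact n (k' - z)) *
        (ff n (2 * a - k' + z) z / qfact n z) * (ff n (2 * b - k + t - z) (t - z) / qfact n (t - z)) *
        (ff n (2 * d - t + z) (k + z - t) / qfact n (k + z - t)) else 0) =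
    ((-1) ^ t * ff n (2 * c + 1 + k') k' * ff n (2 * d) k /
      (ff n (2 * c + 1 + t) t * qfact n k * qfact n k')) *
    (poch n (-k) (t - z) * poch n (2 * b - k + 1) (t - z) * poch n (-(2 * c + 1 + t)) (t - z) /
      poch n (-(2 * d)) (t - z) * poch n (k' - t + 1 + (t - z : ℕ)) (t - (t - z)) *
      poch n (2 * a - k' + 1) (t - (t - z)) / (qfact n (t - z) * qfact n (t - (t - z)))) := by
  have hn : n ≠ 0 := by omega
  -- The index of the series is y = t - z. Outside the support it vanishes by itself: (-k)_y
  -- contains {0} if y > k, and the factor with k' contains {0} if z > k'.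
  obtain ⟨y, rfl⟩ : ∃ y, t = z + y := ⟨t - z, by omega⟩
  rw [Nat.add_sub_cancel_left, Nat.add_sub_cancel]
  by_cases h : z + y ≤ k + z ∧ z ≤ k'
  · obtain ⟨h1, h2⟩ := h
    obtain ⟨p, rfl⟩ : ∃ p, k = y + p := ⟨k - y, by omega⟩
    obtain ⟨q, rfl⟩ : ∃ q, k' = z + q := ⟨k' - z, by omega⟩
    rw [if_pos (by omega), Nat.add_sub_cancel_left, show y + p + z - (z + y) = p by omega]
    have e1 : poch n (2 * a - (z + q : ℕ) + 1) z = ff n (2 * a - (z + q : ℕ) + z) z :=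
      poch_eq_ff z (by ring)
    have e2 : poch n (2 * b - (y + p : ℕ) + 1) y = ff n (2 * b - (y + p : ℕ) + (z + y : ℕ) - z) y :=
      poch_eq_ff y (by push_cast; ring)
    have e3 : poch n (((z + q : ℕ) : ℂ) - (z + y : ℕ) + 1 + y) z * qfact n q = qfact n (z + q) := by
      rw [add_comm z q, qfact_add, mul_comm]
      congr 2
      push_cast
      ring
    have e4 : ff n ((y + p : ℕ) : ℂ) y * qfact n p = qfact n (y + p) := by
      rw [add_comm y p]; exact ff_natCast_mul_qfact n p y
    have e5 : ff n (2 * d) (y + p) = ff n (2 * d) y * ff n (2 * d - (z + y : ℕ) + z) p := by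
      rw [ff_add]
      congr 2
      push_cast
      ring
    have e6 : ff n (2 * c + 1 + (z + q : ℕ)) (z + q) * ff n (2 * c + 1 + (z + y : ℕ)) y =
        ff n (2 * c + (z + q : ℕ) + 1) q * ff n (2 * c + 1 + (z + y : ℕ)) (z + y) := by
      rw [add_comm z q, ff_add n _ q z, add_comm z y, ff_add n _ y z]
      have f1 : 2 * c + 1 + ((q + z : ℕ) : ℂ) - q = 2 * c + 1 + z := by push_cast; ring
      have f2 : 2 * c + 1 + ((y + z : ℕ) : ℂ) - y = 2 * c + 1 + z := by push_cast; ring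
      have f3 : 2 * c + 1 + ((q + z : ℕ) : ℂ) = 2 * c + ((q + z : ℕ) : ℂ) + 1 := by ring
      rw [f1, f2, f3]
      ring
    have g1 : ff n (2 * c + 1 + (z + y : ℕ)) (z + y) ≠ 0 :=
      ff_ne_zero hn (hc.add_int (1 + (z + y : ℕ)) (by push_cast; ring)) _
    have g2 := ff_ne_zero hn hd y
    have g3 := qfact_ne_zero hk
    have g4 := qfact_ne_zero hk'
    have g5 := qfact_ne_zero (show z < n by omega)
    have g6 := qfact_ne_zero (show y < n by omega)
    have g7 := qfact_ne_zero (show p < n by omega)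
    have g8 := qfact_ne_zero (show q < n by omega)
    have hsq : ((-1 : ℂ) ^ y) ^ 2 = 1 := by rw [← pow_mul, mul_comm, pow_mul]; simp
    rw [e1, e2, poch_neg, poch_neg, poch_neg, e5, ← e3, ← e4, pow_add]
    rw [← e3] at g4
    rw [← e4] at g3
    have g9 := left_ne_zero_of_mul g4
    have g10 := left_ne_zero_of_mul g3
    generalize poch n (((z + q : ℕ) : ℂ) - (z + y : ℕ) + 1 + y) z = x₁ at *
    generalize ff n ((y + p : ℕ) : ℂ) y = x₂ at *
    generalize ff n (2 * c + 1 + (z + q : ℕ)) (z + q) = x₃ at *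
    generalize ff n (2 * c + 1 + (z + y : ℕ)) y = x₄ at *
    generalize ff n (2 * c + (z + q : ℕ) + 1) q = x₅ at *
    generalize ff n (2 * c + 1 + (z + y : ℕ)) (z + y) = x₆ at *
    generalize ff n (2 * d) y = x₇ at *
    generalize ff n (2 * d - (z + y : ℕ) + z) p = x₈ at *
    generalize ff n (2 * a - (z + q : ℕ) + z) z = x₉ at *
    generalize ff n (2 * b - (y + p : ℕ) + (z + y : ℕ) - z) y = x₁₀ at *
    generalize (-1 : ℂ) ^ y = σ at *
    have hσ : σ ≠ 0 := by rintro rfl; norm_num at hsq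
    field_simp
    rw [hsq]
    linear_combination -(x₈ * x₉ * x₁₀) * e6
  · rw [if_neg (by omega)]
    rw [not_and_or, not_le, not_le] at h
    rcases h with h | h
    · have : poch n (-(k : ℂ)) y = 0 :=
        Finset.prod_eq_zero (i := k) (by rw [Finset.mem_range]; omega) (by simp [br_zero])
      rw [this]
      simp
    · have : poch n ((k' : ℂ) - (z + y : ℕ) + 1 + y) z = 0 := by
        refine Finset.prod_eq_zero (i := z - 1 - k') (by rw [Finset.mem_range]; omega) ?_
        rw [Nat.cast_sub (by omega), Nat.cast_sub (by omega)]
        push_cast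
        ring_nf
        exact br_zero n
      rw [this]
      simp

/-- The summand of the solution of the triangular system, as a summand of the right side of
`sears`. -/
theorem solution_summand {n k k' k₀ t w : ℕ} (hk : k < n) (ht : t < n)
    (hN : k + k' = k₀ + t) {a b d e : ℂ} (he : NotInt (2 * e)) (hd : NotInt (2 * d))
    (hγ : NotInt (2 * (b + d))) (hwt : w ≤ t) (hw : k₀ + t < w + n) :
    triInv n (2 * (b + d)) k w * (qfact n (k₀ + t - w) / (ff n (2 * d) w * qfact n w) *
      (ff n (2 * a - k₀) (t - w) / (qfact n (t - w) * ff n (2 * e) (t - w)))) =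
    ((-1) ^ k * qfact n k₀ /
      (qfact n k * ff n (2 * (b + d) - k + 1) k * ff n (2 * e) t)) *
    (poch n (-k) w * poch n (-(2 * (b + d) - k + 1)) w * poch n (2 * e - t + 1) w /
      poch n (-(2 * d)) w * poch n (k₀ + 1) (t - w) * poch n (2 * a - k₀ - t + 1 + w) (t - w) /
      (qfact n w * qfact n (t - w))) := by
  have hn : n ≠ 0 := by omega
  obtain ⟨s, rfl⟩ : ∃ s, t = w + s := ⟨t - w, by omega⟩
  rw [Nat.add_sub_cancel_left, show k₀ + (w + s) - w = k₀ + s by omega]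
  by_cases h : w ≤ k
  · obtain ⟨p, rfl⟩ : ∃ p, k = w + p := ⟨k - w, by omega⟩
    rw [triInv, if_pos h, Nat.add_sub_cancel_left]
    have e1 : poch n (2 * e - (w + s : ℕ) + 1) w * ff n (2 * e) s = ff n (2 * e) (w + s) := by
      rw [add_comm w s, ff_add, mul_comm]
      congr 1
      apply poch_eq_ff
      push_cast
      ring
    have e2 : poch n (2 * a - k₀ - (w + s : ℕ) + 1 + w) s = ff n (2 * a - k₀) s :=
      poch_eq_ff s (by push_cast; ring)
    have e3 : ff n (2 * (b + d) - (w + p : ℕ) + 1) (w + p) =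
        ff n (2 * (b + d) - (w + p : ℕ) + 1) w *
          ff n (2 * (b + d) - (w + p : ℕ) - w + 1) p := by
      rw [ff_add]
      congr 2
      ring
    have e4 : ff n ((w + p : ℕ) : ℂ) w * qfact n p = qfact n (w + p) := by
      rw [add_comm w p]; exact ff_natCast_mul_qfact n p w
    have g0 : ff n (2 * (b + d) - (w + p : ℕ) + 1) (w + p) ≠ 0 :=
      ff_ne_zero hn (hγ.add_int (1 - (w + p : ℕ)) (by push_cast; ring)) _
    have g1 := ff_ne_zero hn hd w
    have g2 := ff_ne_zero hn he (w + s)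
    have g3 := qfact_ne_zero hk
    have g5 := qfact_ne_zero (show w < n by omega)
    have g6 := qfact_ne_zero (show s < n by omega)
    have g7 := qfact_ne_zero (show p < n by omega)
    have hsq : ((-1 : ℂ) ^ w) ^ 2 = 1 := by rw [← pow_mul, mul_comm, pow_mul]; simp
    rw [e2, poch_neg, poch_neg, poch_neg, qfact_add, e3, ← e4, ← e1, pow_add]
    rw [e3] at g0
    rw [← e4] at g3
    rw [← e1] at g2
    have g8 := left_ne_zero_of_mul g0
    have g9 := right_ne_zero_of_mul g0
    have g10 := left_ne_zero_of_mul g2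
    have g11 := right_ne_zero_of_mul g2
    have g12 := left_ne_zero_of_mul g3
    generalize poch n (2 * e - (w + s : ℕ) + 1) w = x₁ at *
    generalize ff n (2 * e) s = x₂ at *
    generalize ff n (2 * a - k₀) s = x₃ at *
    generalize ff n (2 * (b + d) - (w + p : ℕ) + 1) w = x₄ at *
    generalize ff n (2 * (b + d) - (w + p : ℕ) - w + 1) p = x₅ at *
    generalize ff n ((w + p : ℕ) : ℂ) w = x₆ at *
    generalize ff n (2 * d) w = x₇ at *
    generalize (-1 : ℂ) ^ w = σ at *
    have hσ : σ ≠ 0 := by rintro rfl; norm_num at hsq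
    field_simp
    rw [hsq, mul_one]
  · have : poch n (-(k : ℂ)) w = 0 :=
      Finset.prod_eq_zero (i := k) (by rw [Finset.mem_range]; omega) (by simp [br_zero])
    rw [triInv, if_neg h, this]
    simp

/-- The defining relation of the `6j`-symbols as a triangular linear system. -/
theorem isSixJ_iff {n : ℕ} (hn : 2 ≤ n) {a b e d c : ℂ} {k₀ t : ℕ} (hk₀ : k₀ < n) (ht : t < n)
    (h₁ : a + b - e = k₀) (h₂ : e + d - c = t) (he : NotHalfInt e) (hd : NotHalfInt d)
    (hc : NotHalfInt c) (hbd : NotHalfInt (b + d)) (X : ℂ → ℂ) :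
    IsSixJ n a b e d c X ↔ ∀ w ∈ Finset.Icc (k₀ + t - (n - 1)) (min (k₀ + t) (n - 1)),
      leftCoef n a e d c k₀ t (k₀ + t - w) w =
        ∑ k ∈ Finset.Icc (k₀ + t - (n - 1)) (min (k₀ + t) (n - 1)),
          (X (b + d - k) * rightCoef n d (b + d - k) c k (k₀ + t - k)) *
            tri n (2 * (b + d)) w k := by
  set N := k₀ + t with hNdef
  set s := Finset.Icc (N - (n - 1)) (min N (n - 1)) with hs
  have hn0 : n ≠ 0 := by omega
  have hN : a + b + d - c = N := by rw [hNdef]; push_cast; linear_combination h₁ + h₂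
  have hf : ∀ k : ℕ, NotHalfInt (b + d - k) := fun k => hbd.add_int (-k) (by push_cast; ring)
  have hk' : ∀ k ∈ s, k < n ∧ N - k < n ∧ k ≤ N ∧ a + (b + d - k) - c = (N - k : ℕ) := by
    intro k hk
    rw [hs, Finset.mem_Icc] at hk
    refine ⟨by omega, by omega, by omega, ?_⟩
    rw [Nat.cast_sub (by omega)]
    linear_combination hN
  have hsum : ∑ x ∈ channels n a b d c, X x • rightIncl n a b d c x =
      ∑ k ∈ s, X (b + d - k) • rightIncl n a b d c (b + d - k) := by
    rw [channels_eq hn0 hN, Finset.sum_image]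
    intro x _ y _ hxy
    simpa using hxy
  have hcoord : ∀ u < n, ∀ w < n, coord₃ n u 0 w ((∑ k ∈ s, X (b + d - k) •
      rightIncl n a b d c (b + d - k)) (wt n 0)) =
      if u + w = N then slicePhase n a b d c u w * ∑ k ∈ s,
        (X (b + d - k) * rightCoef n d (b + d - k) c k (N - k)) * tri n (2 * (b + d)) w k
      else 0 := by
    intro u hu w hw
    rw [LinearMap.sum_apply, map_sum]
    have : ∀ k ∈ s, coord₃ n u 0 w ((X (b + d - k) • rightIncl n a b d c (b + d - k)) (wt n 0)) =
        if u + w = N then slicePhase n a b d c u w *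
          ((X (b + d - k) * rightCoef n d (b + d - k) c k (N - k)) * tri n (2 * (b + d)) w k)
        else 0 := by
      intro k hk
      obtain ⟨p1, p2, p3, p4⟩ := hk' k hk
      rw [LinearMap.smul_apply, map_smul, rightIncl_coord hn p1 p2 (by ring) p4 (hf k) hd hu hw,
        show k + (N - k) = N by omega]
      split_ifs
      · rw [smul_eq_mul]; ring
      · simp
    rw [Finset.sum_congr rfl this]
    split_ifs
    · rw [Finset.mul_sum]
    · simp
  rw [IsSixJ, hsum]
  constructor
  -- One direction reads off the coordinate at u = N - w and cancels the nonzero `slicePhase`.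
  · intro h w hw
    obtain ⟨p1, p2, p3, -⟩ := hk' w hw
    have h' := congrArg (fun g => coord₃ n (N - w) 0 w (g (wt n 0))) h
    rw [leftIncl_coord hn hk₀ ht h₁ h₂ he hd p2 p1, hcoord _ p2 _ p1, if_pos (by omega),
      if_pos (by omega)] at h'
    exact mul_left_cancel₀ (slicePhase_ne_zero hn0 a b c hd p2) h'
  · intro h
    have hL : IsModuleMap n (rep n c)
        (tensorRep n (rep n a) (tensorRep n (rep n b) (rep n d))) (leftIncl n a b d c e) :=
      (isModuleMap_assoc _ _ _).comp
        (((Y_isModuleMap hn hk₀ he h₁).rTensor _).comp (Y_isModuleMap hn ht hc h₂))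
    have hR : ∀ k ∈ s, IsModuleMap n (rep n c)
        (tensorRep n (rep n a) (tensorRep n (rep n b) (rep n d)))
        (rightIncl n a b d c (b + d - k)) := by
      intro k hk
      obtain ⟨p1, p2, p3, p4⟩ := hk' k hk
      exact ((Y_isModuleMap hn p1 (hf k) (by ring)).lTensor _).comp (Y_isModuleMap hn p2 hc p4)
    -- For the converse, the difference of the two sides is a module map, so it suffices to compare
    -- the coordinates at e_u ⊗ e_0 ⊗ e_w of the image of e_0.
    have hD : IsModuleMap n (rep n c)
        (tensorRep n (rep n a) (tensorRep n (rep n b) (rep n d)))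
        (leftIncl n a b d c e - ∑ k ∈ s, X (b + d - k) • rightIncl n a b d c (b + d - k)) := by
      intro x m
      simp only [LinearMap.sub_apply, LinearMap.sum_apply, LinearMap.smul_apply, map_sub, map_sum,
        map_smul]
      rw [hL x m]
      congr 1
      exact Finset.sum_congr rfl fun k hk => by rw [hR k hk x m]
    rw [← sub_eq_zero]
    refine eq_zero_of_map_wt_zero hn hc hD (eq_zero_of_E_eq_zero hn a b d ?_ fun u hu w hw => ?_)
    · rw [← hD, rep_E, opE, ofWt_wt n _ (by omega), Nat.cast_zero, qnum_zero, zero_smul, map_zero]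
    · rw [LinearMap.sub_apply, map_sub, hcoord u hu w hw,
        leftIncl_coord hn hk₀ ht h₁ h₂ he hd hu hw]
      split_ifs with huw
      · rw [← h w (by rw [hs, Finset.mem_Icc]; omega), show N - w = u by omega, sub_self]
      · simp

/-- The solution of the triangular system is the closed formula. -/
theorem solution_eq_closed {n : ℕ} {a b c d e f : ℂ} {k₀ t k k' : ℕ} (hk₀ : k₀ < n)
    (ht : t < n) (hk : k < n) (hk' : k' < n) (hN : k + k' = k₀ + t)
    (h₁ : a + b - e = k₀) (h₂ : e + d - c = t) (h₃ : b + d - f = k)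
    (hc : NotHalfInt c) (hd : NotHalfInt d) (he : NotHalfInt e) (hf : NotHalfInt f) :
    ∑ w ∈ Finset.Icc (k₀ + t - (n - 1)) (min (k₀ + t) (n - 1)),
      triInv n (2 * (b + d)) k w * leftCoef n a e d c k₀ t (k₀ + t - w) w =
    ((-1) ^ (n - 1 + k') * (qbin n (2 * f + n) (2 * f + 1))⁻¹ *
        (qfact n t * qfact n k₀ / (qfact n k * qfact n k')) *
        qbin n (2 * e) (A a b e + 1 - n) * (qbin n (2 * e) (B e c d))⁻¹ *
        ∑ z ∈ Finset.Icc (t - k) (min t k'),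
          (-1) ^ z * qbin n (A a f c + 1) (2 * c + z + 1) * qbin n (B a c f + z) (B a c f) *
            qbin n (B b f d + t - z) (B b f d) * qbin n (B d c e + z) (B d f b)) *
      rightCoef n d f c k k' := by
  have hn : n ≠ 0 := by omega
  have hNc : (k : ℂ) + k' = k₀ + t := by exact_mod_cast hN
  have hγ : NotInt (2 * (b + d)) :=
    hf.two_mul.add_int (2 * k) (by push_cast; linear_combination 2 * h₃)
  -- The parameters are read off from the two summand lemmas: the first series comes from
  -- `closed_summand`, the second from `solution_summand`. With f in place of b+d-k, the first
  -- argument is -(2f+1+k).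
  have hS := sears ht (-(2 * (b + d) - k + 1)) (2 * e - t + 1) (-(2 * d)) (k' - t + 1) (-k)
    (k₀ + k' - 2 * a) (2 * a - k' + 1) (by linear_combination hNc - 2 * h₁)
    (by linear_combination -hNc)
    (fun y _ => poch_ne_zero hn hd.two_mul.neg y)
  have a1 : -(2 * d) - -(2 * (b + d) - k + 1) = 2 * b - k + 1 := by ring
  have a2 : -(2 * d) - (2 * e - t + 1) = -(2 * c + 1 + t) := by linear_combination -2 * h₂
  have a3 : (k' : ℂ) - t + 1 - -k = k₀ + 1 := by linear_combination hNc
  have a4 : ∀ i : ℕ, (k' : ℂ) - t + 1 + i - (k₀ + k' - 2 * a) = 2 * a - k₀ - t + 1 + i :=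
    fun i => by ring
  simp only [a1, a2, a3, a4] at hS
  have hleft : ∑ w ∈ Finset.Icc (k₀ + t - (n - 1)) (min (k₀ + t) (n - 1)),
      triInv n (2 * (b + d)) k w * leftCoef n a e d c k₀ t (k₀ + t - w) w =
      (qbin n (2 * e) (2 * e - (n - 1 - k₀ : ℕ)) * qbin n (2 * c) (2 * c - (n - 1 - t : ℕ)) *
      qfact n t) * ((-1) ^ k * qfact n k₀ /
      (qfact n k * ff n (2 * (b + d) - k + 1) k * ff n (2 * e) t)) *
      ∑ i ∈ Finset.range (t + 1), poch n (-k) i * poch n (-(2 * (b + d) - k + 1)) i *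
        poch n (2 * e - t + 1) i / poch n (-(2 * d)) i * poch n (k₀ + 1) (t - i) *
        poch n (2 * a - k₀ - t + 1 + i) (t - i) / (qfact n i * qfact n (t - i)) := by
    have h : ∑ w ∈ Finset.Icc (k₀ + t - (n - 1)) (min (k₀ + t) (n - 1)),
        triInv n (2 * (b + d)) k w * leftCoef n a e d c k₀ t (k₀ + t - w) w =
        ∑ w ∈ Finset.Icc (k₀ + t - (n - 1)) t,
          triInv n (2 * (b + d)) k w * leftCoef n a e d c k₀ t (k₀ + t - w) w := by
      symm
      apply Finset.sum_subset
      · exact Finset.Icc_subset_Icc le_rfl (by omega)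
      · intro w hw hw'
        rw [Finset.mem_Icc] at hw hw'
        rw [leftCoef, if_neg (by omega), mul_zero]
    rw [h, Finset.mul_sum]
    apply Finset.sum_subset_zero_on_sdiff
    · intro w hw
      rw [Finset.mem_Icc] at hw
      rw [Finset.mem_range]
      omega
    · intro w hw
      rw [Finset.mem_sdiff, Finset.mem_range, Finset.mem_Icc] at hw
      -- The system has no equation for these w, but the series may be extended to 0 ≤ w ≤ t: here
      -- (k₀+1)_{t-w} contains {n} = 0.
      have : poch n ((k₀ : ℂ) + 1) (t - w) = 0 := by
        refine Finset.prod_eq_zero (i := n - 1 - k₀) (by rw [Finset.mem_range]; omega) ?_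
        rw [Nat.cast_sub (by omega), Nat.cast_sub (by omega), Nat.cast_one,
          show (k₀ : ℂ) + 1 + (n - 1 - k₀) = n by ring, br_natCast_self]
      rw [this]
      simp
    · intro w hw
      rw [Finset.mem_Icc] at hw
      rw [mul_assoc (qbin n (2 * e) _ * qbin n (2 * c) _ * qfact n t),
        ← solution_summand hk ht hN he.two_mul hd.two_mul hγ hw.2 (by omega), leftCoef,
        if_pos hw.2]
      ring
  have hright : ∑ z ∈ Finset.Icc (t - k) (min t k'),
      (-1) ^ z * qbin n (A a f c + 1) (2 * c + z + 1) * qbin n (B a c f + z) (B a c f) *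
        qbin n (B b f d + t - z) (B b f d) * qbin n (B d c e + z) (B d f b) =
      ((-1) ^ t * ff n (2 * c + 1 + k') k' * ff n (2 * d) k /
      (ff n (2 * c + 1 + t) t * qfact n k * qfact n k')) *
      ∑ y ∈ Finset.range (t + 1), poch n (-k) y * poch n (2 * b - k + 1) y *
        poch n (-(2 * c + 1 + t)) y / poch n (-(2 * d)) y * poch n (k' - t + 1 + y) (t - y) *
        poch n (2 * a - k' + 1) (t - y) / (qfact n y * qfact n (t - y)) := by
    rw [← Finset.sum_range_reflect, Finset.mul_sum]
    apply Finset.sum_subset_zero_on_sdiff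
    · intro z hz
      rw [Finset.mem_Icc] at hz
      rw [Finset.mem_range]
      omega
    · intro z hz
      rw [Finset.mem_sdiff, Finset.mem_range, Finset.mem_Icc] at hz
      rw [show t + 1 - 1 - z = t - z by omega, ← closed_summand hk hk' ht hN hc.two_mul hd.two_mul
        (by omega), if_neg (by omega)]
    · intro z hz
      rw [Finset.mem_Icc] at hz
      rw [show t + 1 - 1 - z = t - z by omega, ← closed_summand hk hk' ht hN hc.two_mul hd.two_mul
        (by omega), if_pos (by omega)]
      have c1 : ((k' - z : ℕ) : ℂ) = k' - z := Nat.cast_sub (by omega)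
      have c2 : ((t - z : ℕ) : ℂ) = t - z := Nat.cast_sub (by omega)
      have c3 : ((k + z - t : ℕ) : ℂ) = k + z - t := by
        rw [Nat.cast_sub (by omega)]; push_cast; rfl
      simp only [A, B]
      rw [qbin_eq_ff (m := k' - z) (by omega)
          (by rw [c1]; linear_combination h₁ + h₂ - h₃ - hNc),
        qbin_eq_ff (m := z) (by omega) (by ring),
        qbin_eq_ff (m := t - z) (by omega) (by rw [c2]; ring),
        qbin_eq_ff (m := k + z - t) (by omega) (by rw [c3]; linear_combination h₃ - h₂),
        show a + f + c + 1 = 2 * c + k' + 1 by linear_combination h₁ + h₂ - h₃ - hNc,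
        show a + c - f + z = 2 * a - k' + z by linear_combination hNc + h₃ - h₁ - h₂,
        show b + f - d + t - z = 2 * b - k + t - z by linear_combination -h₃,
        show d + c - e + z = 2 * d - t + z by linear_combination -h₂]
  have q1 : A a b e + 1 - n = 2 * e - (n - 1 - k₀ : ℕ) := by
    rw [A, Nat.cast_sub (by omega), Nat.cast_sub (by omega), Nat.cast_one]
    linear_combination h₁
  have q2 : 2 * e - B e c d = t := by rw [B]; linear_combination h₂
  -- Only prefactors are left to compare. The complementary forms at 2c, and likewise at 2f, share
  -- the factor {2c}⋯{2c-n+2}/{n-1}! (respectively with 2f), which cancels; [2f+n; 2f+1] supplies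
  -- the one at 2f and the sign (-1)^(n-1).
  rw [hleft, hright, hS, q1, qbin_eq_ff ht q2, rightCoef, qbin_compl hk hf.two_mul,
    qbin_compl hk' hc.two_mul, qbin_compl ht hc.two_mul, qbin_add_self hn,
    show 2 * (b + d) - k + 1 = 2 * f + 1 + k by linear_combination 2 * h₃]
  generalize ∑ i ∈ Finset.range (t + 1), poch n (-(k : ℂ)) i *
    poch n (-(2 * f + 1 + k)) i * poch n (2 * e - t + 1) i / poch n (-(2 * d)) i *
    poch n (k₀ + 1) (t - i) * poch n (2 * a - k₀ - t + 1 + i) (t - i) /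
    (qfact n i * qfact n (t - i)) = T
  have g1 := ff_ne_zero hn hf.two_mul (n - 1)
  have g2 := ff_ne_zero hn hc.two_mul (n - 1)
  have g3 := ff_ne_zero hn (hf.two_mul.add_int (1 + k) (y := 2 * f + 1 + k) (by push_cast; ring)) k
  have g4 := ff_ne_zero hn (hc.two_mul.add_int (1 + k') (y := 2 * c + 1 + k')
    (by push_cast; ring)) k'
  have g5 := ff_ne_zero hn (hc.two_mul.add_int (1 + t) (y := 2 * c + 1 + t) (by push_cast; ring)) t
  have g6 := ff_ne_zero hn he.two_mul t
  have g7 := ff_ne_zero hn hd.two_mul k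
  have g8 := qfact_ne_zero hk
  have g9 := qfact_ne_zero hk'
  have g10 := qfact_ne_zero ht
  have g11 := qfact_ne_zero (show n - 1 < n by omega)
  generalize qbin n (2 * e) (2 * e - (n - 1 - k₀ : ℕ)) = x₀
  generalize ff n (2 * f) (n - 1) = x₁ at *
  generalize ff n (2 * c) (n - 1) = x₂ at *
  generalize ff n (2 * f + 1 + k) k = x₃ at *
  generalize ff n (2 * c + 1 + k') k' = x₄ at *
  generalize ff n (2 * c + 1 + t) t = x₅ at *
  generalize ff n (2 * e) t = x₆ at *
  generalize ff n (2 * d) k = x₇ at *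
  have hsq : ((-1 : ℂ) ^ k') ^ 2 = 1 := by rw [← pow_mul, mul_comm, pow_mul]; simp
  rw [pow_add]
  field_simp
  rw [hsq]
  ring

theorem rightCoef_ne_zero {n k k' : ℕ} (hk : k < n) (hk' : k' < n) {d f c : ℂ} (hc : NotHalfInt c)
    (hd : NotHalfInt d) (hf : NotHalfInt f) : rightCoef n d f c k k' ≠ 0 := by
  have hn : n ≠ 0 := by omega
  rw [rightCoef, qbin_eq_ff (m := n - 1 - k) (by omega) (by ring),
    qbin_eq_ff (m := n - 1 - k') (by omega) (by ring)]
  have g1 := ff_ne_zero hn hf.two_mul (n - 1 - k)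
  have g2 := ff_ne_zero hn hc.two_mul (n - 1 - k')
  have g3 := ff_ne_zero hn hd.two_mul k
  have g4 := qfact_ne_zero hk'
  have g5 := qfact_ne_zero (show n - 1 - k < n by omega)
  have g6 := qfact_ne_zero (show n - 1 - k' < n by omega)
  positivity

end SL2SixJ

/-! ### Assembly of the theorem -/

theorem mainTheorem3 (n : ℕ) (hn : 2 ≤ n) (a b c d e f : ℂ)
    (ha : SL2SixJ.NotHalfInt a) (hb : SL2SixJ.NotHalfInt b) (hc : SL2SixJ.NotHalfInt c)
    (hd : SL2SixJ.NotHalfInt d) (he : SL2SixJ.NotHalfInt e) (hf : SL2SixJ.NotHalfInt f)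
    (Babe Bafc Bbdf Bdec : ℕ)
    (habe_lt : Babe < n) (hafc_lt : Bafc < n) (hbdf_lt : Bbdf < n) (hdec_lt : Bdec < n)
    (habe : SL2SixJ.B a b e = Babe) (hafc : SL2SixJ.B a f c = Bafc)
    (hbdf : SL2SixJ.B b d f = Bbdf) (hdec : SL2SixJ.B d e c = Bdec) :
    -- the four inclusions of the definition are maps of modules
    (SL2SixJ.IsModuleMap n (SL2SixJ.rep n e)
        (SL2SixJ.tensorRep n (SL2SixJ.rep n a) (SL2SixJ.rep n b)) (SL2SixJ.Y n a b e) ∧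
      SL2SixJ.IsModuleMap n (SL2SixJ.rep n c)
        (SL2SixJ.tensorRep n (SL2SixJ.rep n e) (SL2SixJ.rep n d)) (SL2SixJ.Y n e d c) ∧
      SL2SixJ.IsModuleMap n (SL2SixJ.rep n f)
        (SL2SixJ.tensorRep n (SL2SixJ.rep n b) (SL2SixJ.rep n d)) (SL2SixJ.Y n b d f) ∧
      SL2SixJ.IsModuleMap n (SL2SixJ.rep n c)
        (SL2SixJ.tensorRep n (SL2SixJ.rep n a) (SL2SixJ.rep n f)) (SL2SixJ.Y n a f c)) ∧
    -- the defining relation has a solution, and `sixJ` is the only one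
    (SL2SixJ.IsSixJ n a b e d c (fun x => SL2SixJ.sixJ n a b e d c x) ∧
      ∀ X : ℂ → ℂ, SL2SixJ.IsSixJ n a b e d c X →
        ∀ x ∈ SL2SixJ.channels n a b d c, X x = SL2SixJ.sixJ n a b e d c x) ∧
    f ∈ SL2SixJ.channels n a b d c ∧
    -- the closed formula; in the lower limit, `Bdec - Bbdf` in `ℕ` is `max (0, Bdec - Bbdf)`
    SL2SixJ.sixJ n a b e d c f =
      (-1) ^ (n - 1 + Bafc) * (SL2SixJ.qbin n (2 * f + n) (2 * f + 1))⁻¹ *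
        (SL2SixJ.qfact n Bdec * SL2SixJ.qfact n Babe /
          (SL2SixJ.qfact n Bbdf * SL2SixJ.qfact n Bafc)) *
        SL2SixJ.qbin n (2 * e) (SL2SixJ.A a b e + 1 - n) *
        (SL2SixJ.qbin n (2 * e) (SL2SixJ.B e c d))⁻¹ *
        ∑ z ∈ Finset.Icc (Bdec - Bbdf) (min Bdec Bafc),
          (-1) ^ z *
            SL2SixJ.qbin n (SL2SixJ.A a f c + 1) (2 * c + z + 1) *
            SL2SixJ.qbin n (SL2SixJ.B a c f + z) (SL2SixJ.B a c f) *
            SL2SixJ.qbin n (SL2SixJ.B b f d + Bdec - z) (SL2SixJ.B b f d) *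
            SL2SixJ.qbin n (SL2SixJ.B d c e + z) (SL2SixJ.B d f b) := by
  have h₁ : a + b - e = Babe := habe
  have h₂ : e + d - c = Bdec := by rw [← hdec, SL2SixJ.B, add_comm e d]
  have h₃ : b + d - f = Bbdf := hbdf
  have h₄ : a + f - c = Bafc := hafc
  have hN : Bbdf + Bafc = Babe + Bdec := by
    have : ((Bbdf + Bafc : ℕ) : ℂ) = ((Babe + Bdec : ℕ) : ℂ) := by
      push_cast
      linear_combination h₁ + h₂ - h₃ - h₄
    exact_mod_cast this
  have hn0 : n ≠ 0 := by omega
  have hbd : SL2SixJ.NotHalfInt (b + d) := hf.add_int Bbdf (by push_cast; linear_combination h₃)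
  have hfk : ∀ k : ℕ, SL2SixJ.NotHalfInt (b + d - k) :=
    fun k => hbd.add_int (-k) (by push_cast; ring)
  have hNc : a + b + d - c = (Babe + Bdec : ℕ) := by push_cast; linear_combination h₁ + h₂
  -- The unknowns of the linear system are the products X(b+d-k) · `rightCoef`; the right side is
  -- their explicit value.
  have hiff : ∀ X : ℂ → ℂ, SL2SixJ.IsSixJ n a b e d c X ↔ _ := fun X =>
    (SL2SixJ.isSixJ_iff hn habe_lt hdec_lt h₁ h₂ he hd hc hbd X).trans
      (SL2SixJ.solve_of_leftInverse _ (SL2SixJ.tri n (2 * (b + d)))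
        (SL2SixJ.triInv n (2 * (b + d)))
        (fun k hk k' hk' => SL2SixJ.sum_triInv_mul_tri (by omega) _ hbd.two_mul hk hk')
        (fun k => X (b + d - k) *
          SL2SixJ.rightCoef n d (b + d - k) c k (Babe + Bdec - k))
        (fun w => SL2SixJ.leftCoef n a e d c Babe Bdec (Babe + Bdec - w) w))
  have hmem : ∀ k ∈ Finset.Icc (Babe + Bdec - (n - 1)) (min (Babe + Bdec) (n - 1)),
      SL2SixJ.rightCoef n d (b + d - k) c k (Babe + Bdec - k) ≠ 0 := by
    intro k hk
    rw [Finset.mem_Icc] at hk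
    exact SL2SixJ.rightCoef_ne_zero (by omega) (by omega) hc hd (hfk k)
  have hex : ∃ X, SL2SixJ.IsSixJ n a b e d c X := by
    classical
    -- A function on all of ℂ with prescribed values at the distinct points b+d-k and 0 elsewhere,
    -- written as a sum of indicators.
    refine ⟨fun x => ∑ k ∈ Finset.Icc (Babe + Bdec - (n - 1)) (min (Babe + Bdec) (n - 1)),
      if x = b + d - k then (∑ w ∈ Finset.Icc (Babe + Bdec - (n - 1)) (min (Babe + Bdec) (n - 1)),
        SL2SixJ.triInv n (2 * (b + d)) k w *
          SL2SixJ.leftCoef n a e d c Babe Bdec (Babe + Bdec - w) w) /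
        SL2SixJ.rightCoef n d (b + d - k) c k (Babe + Bdec - k) else 0, (hiff _).mpr fun k hk => ?_⟩
    have hr := hmem k hk
    rw [Finset.sum_eq_single_of_mem k hk, if_pos rfl, div_mul_cancel₀ _ hr]
    intro l _ hl
    rw [if_neg]
    intro h
    apply hl
    have : (l : ℂ) = k := by linear_combination h
    exact_mod_cast this
  have hsix : SL2SixJ.IsSixJ n a b e d c (fun x => SL2SixJ.sixJ n a b e d c x) := by
    simp only [SL2SixJ.sixJ, dif_pos hex]
    exact hex.choose_spec
  have hBmem : Bbdf ∈ Finset.Icc (Babe + Bdec - (n - 1)) (min (Babe + Bdec) (n - 1)) := by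
    rw [Finset.mem_Icc]
    omega
  have hfB : f = b + d - Bbdf := by linear_combination -h₃
  refine ⟨⟨SL2SixJ.Y_isModuleMap hn habe_lt he h₁, SL2SixJ.Y_isModuleMap hn hdec_lt hc h₂,
    SL2SixJ.Y_isModuleMap hn hbdf_lt hf h₃, SL2SixJ.Y_isModuleMap hn hafc_lt hc h₄⟩,
    ⟨hsix, fun X hX x hx => ?_⟩, ?_, ?_⟩
  · rw [SL2SixJ.channels_eq hn0 hNc, Finset.mem_image] at hx
    obtain ⟨k, hk, rfl⟩ := hx
    have e1 := (hiff X).mp hX k hk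
    have e2 := (hiff _).mp hsix k hk
    exact mul_right_cancel₀ (hmem k hk) (e1.trans e2.symm)
  · rw [SL2SixJ.channels_eq hn0 hNc, Finset.mem_image]
    exact ⟨Bbdf, hBmem, hfB.symm⟩
  -- `sixJ` is defined by a choice of solution; its value at f is the explicit one with k = `Bbdf`,
  -- for which N - k = `Bafc`.
  · have e2 := (hiff _).mp hsix Bbdf hBmem
    have hr := hmem Bbdf hBmem
    simp only [← hfB, show Babe + Bdec - Bbdf = Bafc by omega] at e2 hr
    rw [SL2SixJ.solution_eq_closed habe_lt hdec_lt hbdf_lt hafc_lt hN h₁ h₂ h₃ hc hd he hf] at e2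
    exact mul_right_cancel₀ hr e2
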